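/- **Setting.** Let $H\in(0,1/2)$, $T>0$, $\rho\in[-1,1]$ and $\lambda,\nu\in\mathbb R$. Put $$G(t)=\frac{t^{H-1/2}}{\Gamma(H+1/2)},\qquad c_H=\frac1{\Gamma(H+1/2)\Gamma(1/2-H)},\qquad w(x)=c_Hx^{-H-1/2},\qquad F(z,x)=\tfrac12(z^2-z)+(\rho\nu z-\lambda)x+\tfrac{\nu^2}{2}x^2 .$$ Let $\alpha=1.06418$, $\beta=0.4275$, $A=\big(\tfrac1H+\tfrac1{3/2-H}\big)^{1/2}$, $E=e^{\alpha\beta}$, $\gamma=\big(\tfrac{3E}{8(E-1)}+6H-4H^2\big)^{-1}$ and, for an integer $N\ge1$, $$a_N=T^{-1}\Big(\big(\tfrac{9-6H}{2H}\big)^{\frac{E}{8(E-1)}}\big(\tfrac{5\pi^3}{768}E(E-1)\tfrac{A^{2-2H}(3-2H)}{\beta^{2-2H}H}N^{1-H}\big)^{2H}\Big)^{\gamma},$$ $$b_N=T^{-1}\Big(\big(\tfrac{9-6H}{2H}\big)^{\frac{E}{8(E-1)}}\big(\tfrac{5\pi^3}{1152}E(E-1)\tfrac{A^{2-2H}}{\beta^{2-2H}}N^{1-H}\big)^{2H-3}\Big)^{\gamma}.$$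 Let $m\ge1$ be an integer with $\big|m-\tfrac{\beta}{A}\sqrt N\big|<1$ (that is, rounded up or down), let $n\ge 0$ be an integer for which $|nm-N|$ is minimal, and let $$\xi_0=a_N\exp\Big(-\tfrac{\alpha}{(3/2-H)A}\sqrt N\Big),\qquad \xi_n=b_N\exp\Big(\tfrac{\alpha}{HA}\sqrt N\Big),\qquad \xi_i=\xi_0(\xi_n/\xi_0)^{i/n}.$$ Assume that $\xi_0<\xi_n$, so that the intervals $[\xi_i,\xi_{i+1}]$ are non-degenerate. On each $[\xi_i,\xi_{i+1}]$, $0\le i<n$, take the Gaussian quadrature rule of level $m$ for the weight function $w$ (the $m$ nodes in the interval, with weights, for which all polynomials of degree at most $2m-1$ are integrated exactly), and let $(x_k)_{k=1}^{nm}$, $(w_k)_{k=1}^{nm}$ be all these nodes and weights. Add $x_0=0$, $w_0=\frac{c_H}{1/2-H}\xi_0^{1/2-H}$, and set $\hat G(t)=\sum_{k=0}^{nm}w_ke^{-x_kt}$. For $z\in\mathbb C$ let $\psi(\cdot,z)$ and $\hat\psi(\cdot,z)$ be continuous solutions on $[0,T]$ of $$\psi(t,z)=\int_0^tG(t-s)F(z,\psi(s,z))\,ds,\qquad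 \hat\psi(t,z)=\int_0^t\hat G(t-s)F(z,\hat\psi(s,z))\,ds .$$ **Corollary 3.5 (Riccati solution error, rough Heston).** There is a constant $C>0$, depending only on $H,T,\lambda,\nu,\rho$, such that for all $N\ge1$ with $\xi_0<\xi_n$, all $m,n$ chosen as above, all $a\in[0,1]$ and all $b\in\mathbb R$, $$\sup_{t\in[0,T]}\big|\hat\psi(t,a+ib)-\psi(t,a+ib)\big|\le C(1+b^4)\,N^{0.21}\exp\Big(-\frac{\alpha}{A}\sqrt N\Big).$$ -/

import Mathlib

noncomputable section

namespace RoughHeston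

/-! Kernels -/

/-- The fractional kernel `G(t) = t^(H - 1/2) / Γ(H + 1/2)`. -/
def fracKernel (H t : ℝ) : ℝ := t ^ (H - 1 / 2) / Real.Gamma (H + 1 / 2)

/-- `c_H = 1 / (Γ(H + 1/2) Γ(1/2 - H))`. -/
def cH (H : ℝ) : ℝ := 1 / (Real.Gamma (H + 1 / 2) * Real.Gamma (1 / 2 - H))

/-- The weight function `w(x) = c_H x^(-H - 1/2)`, the density of the Laplace representation
`G(t) = ∫ e^(-xt) w(x) dx` over `(0, ∞)`. -/
def weightFun (H x : ℝ) : ℝ := cH H * x ^ (-H - 1 / 2)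

/-! Gaussian quadrature -/

/-- `x` and `v` are the nodes and weights of the Gaussian quadrature rule of level `m` on `[l, u]`
for the weight function `w`: the `m` nodes lie in `[l, u]`, and the rule integrates every
polynomial of degree at most `2 m - 1` exactly. For `l < u` and `w > 0` this determines
the pairs (node, weight) up to their order. -/
def IsGaussQuadrature (w : ℝ → ℝ) (l u : ℝ) (m : ℕ) (x v : Fin m → ℝ) : Prop :=
  (∀ j, x j ∈ Set.Icc l u) ∧
    ∀ p : Polynomial ℝ, p.natDegree < 2 * m →
      ∑ j, v j * p.eval (x j) = ∫ y in l..u, p.eval y * w y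

/-! Parameters of the node set -/

/-- `α = 1.06418`. -/
def alpha : ℝ := 1.06418

/-- `β = 0.4275`. -/
def beta : ℝ := 0.4275

/-- `A = (1/H + 1/(3/2 - H))^(1/2)`. -/
def bigA (H : ℝ) : ℝ := Real.sqrt (1 / H + 1 / (3 / 2 - H))

/-- `E = e^(α β)`. -/
def expAB : ℝ := Real.exp (alpha * beta)

/-- `γ = (3 E / (8 (E - 1)) + 6 H - 4 H²)⁻¹`. -/
def gam (H : ℝ) : ℝ := (3 * expAB / (8 * (expAB - 1)) + 6 * H - 4 * H ^ 2)⁻¹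

/-- The constant `a` of the rule. -/
def ruleA (H T : ℝ) (N : ℕ) : ℝ :=
  T⁻¹ * (((9 - 6 * H) / (2 * H)) ^ (expAB / (8 * (expAB - 1))) *
    (5 * Real.pi ^ 3 / 768 * expAB * (expAB - 1) *
      (bigA H ^ (2 - 2 * H) * (3 - 2 * H) / (beta ^ (2 - 2 * H) * H)) *
      (N : ℝ) ^ (1 - H)) ^ (2 * H)) ^ gam H

/-- The constant `b` of the rule. -/
def ruleB (H T : ℝ) (N : ℕ) : ℝ :=
  T⁻¹ * (((9 - 6 * H) / (2 * H)) ^ (expAB / (8 * (expAB - 1))) *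
    (5 * Real.pi ^ 3 / 1152 * expAB * (expAB - 1) *
      (bigA H ^ (2 - 2 * H) / beta ^ (2 - 2 * H)) *
      (N : ℝ) ^ (1 - H)) ^ (2 * H - 3)) ^ gam H

/-- The left end `ξ_0 = a exp(-α √N / ((3/2 - H) A))`. -/
def xiLeft (H T : ℝ) (N : ℕ) : ℝ :=
  ruleA H T N * Real.exp (-(alpha / ((3 / 2 - H) * bigA H) * Real.sqrt N))

/-- The right end `ξ_n = b exp(α √N / (H A))`. -/
def xiRight (H T : ℝ) (N : ℕ) : ℝ :=
  ruleB H T N * Real.exp (alpha / (H * bigA H) * Real.sqrt N)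

/-- The geometric grid `ξ_i = ξ_0 (ξ_n / ξ_0)^(i/n)`, `0 ≤ i ≤ n`. -/
def xi (H T : ℝ) (N n i : ℕ) : ℝ :=
  xiLeft H T N * (xiRight H T N / xiLeft H T N) ^ ((i : ℝ) / (n : ℝ))

/-- Admissible integers: `m ≥ 1` is `β √N / A` rounded up or down, and `n` makes `n m` as close
as possible to `N`. -/
def IsLevelAndCount (H : ℝ) (N m n : ℕ) : Prop :=
  1 ≤ m ∧ |(m : ℝ) - beta / bigA H * Real.sqrt N| < 1 ∧
    ∀ k : ℕ, |(n : ℝ) * m - N| ≤ |(k : ℝ) * m - N|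

/-- `x i j` and `v i j` are the positive nodes and their weights: on each
interval `[ξ_i, ξ_(i+1)]`, `i < n`, the Gaussian rule of level `m` for the weight function `w`. -/
def IsGaussianRule (H T : ℝ) (N m n : ℕ) (x v : Fin n → Fin m → ℝ) : Prop :=
  ∀ i : Fin n,
    IsGaussQuadrature (weightFun H) (xi H T N n i) (xi H T N n (i + 1)) m (x i) (v i)

/-- The weight `w_0 = c_H ξ_0^(1/2 - H) / (1/2 - H)` of the additional node `x_0 = 0`. -/
def weightZero (H T : ℝ) (N : ℕ) : ℝ :=
  cH H / (1 / 2 - H) * xiLeft H T N ^ (1 / 2 - H)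

/-- The approximating kernel `Ĝ(t) = w_0 + ∑ w_i e^(-x_i t)`. -/
def approxKernel (H T : ℝ) (N : ℕ) {m n : ℕ} (x v : Fin n → Fin m → ℝ) (t : ℝ) : ℝ :=
  weightZero H T N + ∑ i, ∑ j, v i j * Real.exp (-(x i j * t))

/-! Riccati equations -/

/-- `F(z, x) = (z² - z)/2 + (ρ ν z - λ) x + ν² x² / 2`, with `lam` for `λ`. -/
def riccatiF (lam nu rho : ℝ) (z x : ℂ) : ℂ :=
  1 / 2 * (z ^ 2 - z) + ((rho : ℂ) * nu * z - lam) * x + (nu : ℂ) ^ 2 / 2 * x ^ 2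

/-- `psi` is a continuous solution on `[0, T]` of the Riccati equation
`ψ(t) = ∫₀ᵗ K(t - s) F(z, ψ(s)) ds` with kernel `K`. -/
def IsRiccatiSolution (K : ℝ → ℝ) (lam nu rho T : ℝ) (z : ℂ) (psi : ℝ → ℂ) : Prop :=
  ContinuousOn psi (Set.Icc 0 T) ∧
    ∀ t ∈ Set.Icc (0 : ℝ) T,
      psi t = ∫ s in (0 : ℝ)..t, (K (t - s) : ℂ) * riccatiF lam nu rho z (psi s)

end RoughHeston

end

/-! The rate has two independent sources: an `L¹` estimate for the kernels and a stability estimate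
for the Riccati equation that is linear in the `L¹` distance of the kernels.

Stability. A naive Gronwall argument would lose a factor exponential in `|b|`. Instead, positive
nonincreasing log-convex kernels satisfy a maximum principle (`forcing_nonpos_of_touch`): where `d₀
+ K * p ≥ 0` first touches zero, `p ≤ 0`. It follows from `truncated_conv_ge`: switching off the
forcing does not let a lower bound of `K * g` deteriorate later. Touching a solution from above by a
multiple of an explicit supersolution then turns one-sided bounds on the forcing into bounds on the
solution (`norm_le_of_comparison`, `nonpos_of_comparison`), with constants depending on the kernel
only through a bound `C₀ t^(H-1/2)`. For the Riccati equation on the strip `a ∈ [0,1]`, this gives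
`Re ψ ≤ 0`; then the quadratic term is dissipative for `χ = νψ + iρb`, so `|ν||ψ|` grows at most
linearly in `|b|` and `F` quadratically (`riccati_growth`). The difference of two solutions solves a
linear equation whose coefficient has real part bounded uniformly in `b`, again because `Re ψ ≤ 0`.
Only the factors `1 + |b|` and `1 + b²` survive, and their product is at most `4(1 + b⁴)`
(`riccati_stability`).

Kernels. By the Laplace representation of `G`, the error splits into three parts. Collapsing `[0,
ξ_0]` to the node `0` costs `ξ_0^(3/2-H)`, dropping `(ξ_n, ∞)` costs `ξ_n^(-(H+1/2))`, and Gaussian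
quadrature costs `ε^(2m)`, from a Taylor polynomial at each midpoint (`exists_L1_error_le`). The
exponents in `ξ_0`, `ξ_n` and `m` make each part `O(N^0.21 exp(-α√N/A))`; only the left end needs
the power of `N`. Gaussian weights are positive, so the approximating kernel is a positive sum of
exponentials and hence log-convex; it is dominated uniformly in `N` (`exists_approxKernel_le`), as
the stability estimate requires. -/

open Set MeasureTheory intervalIntegral Filter Topology

/-! ### Log-convex kernels: truncated forcing and the touching principle. -/

namespace RoughHeston

/-- Positive, nonincreasing, log-convex `C¹` functions on `(0, ∞)` that are integrable at `0`. -/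
structure LogConvexKernel (K : ℝ → ℝ) : Prop where
  pos : ∀ t, 0 < t → 0 < K t
  diff : ∀ t, 0 < t → DifferentiableAt ℝ K t
  cont_deriv : ContinuousOn (deriv K) (Ioi 0)
  deriv_nonpos : ∀ t, 0 < t → deriv K t ≤ 0
  ratio : ∀ a b, 0 < a → a ≤ b → deriv K a * K b ≤ deriv K b * K a
  integrable : ∀ t, IntervalIntegrable K volume 0 t

namespace LogConvexKernel

variable {K : ℝ → ℝ}

lemma continuousOn (hK : LogConvexKernel K) : ContinuousOn K (Ioi 0) :=
  fun t ht => (hK.diff t ht).continuousAt.continuousWithinAt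

lemma anti (hK : LogConvexKernel K) {a b : ℝ} (ha : 0 < a) (hab : a ≤ b) : K b ≤ K a := by
  have : AntitoneOn K (Ioi 0) := by
    apply antitoneOn_of_deriv_nonpos (convex_Ioi 0) hK.continuousOn
    · rw [interior_Ioi]; exact fun t ht => (hK.diff t ht).differentiableWithinAt
    · rw [interior_Ioi]; exact fun t ht => hK.deriv_nonpos t ht
  exact this ha (lt_of_lt_of_le ha hab) hab

/-- The continuous extension to `ℝ` of the shifted kernel. -/
lemma continuous_shift (hK : LogConvexKernel K) {e : ℝ} (he : 0 < e) :
    Continuous fun u : ℝ => K (max u 0 + e) := by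
  apply hK.continuousOn.comp_continuous (by fun_prop)
  intro u
  have := le_max_right u 0
  simp only [mem_Ioi]; linarith

/-- One round of a bootstrap for the convolution with forcing cut off at `x`, seen at a later time
`t`. The kernel seen from `t` is `q` times the kernel seen from `x`, and `q` is nonincreasing with
`q 0 ≤ 1`. After integration by parts, the boundary term uses the good bound `m` and the integral
uses the provisional bound `D`; since `q x` is bounded below, a fixed fraction of `D - m` is gained.
-/
lemma shift_step (hK : LogConvexKernel K) {e : ℝ} (he : 0 < e) {g : ℝ → ℝ} (hg : Continuous g)
    {x t T m D : ℝ} (hx : 0 ≤ x) (hxt : x ≤ t) (htT : t ≤ T) (hmD : m ≤ D)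
    (hJ : ∀ s ∈ Icc 0 x, -D ≤ ∫ r in (0 : ℝ)..s, K (max (x - r) 0 + e) * g r) (hD : 0 ≤ D)
    (hm : -m ≤ ∫ r in (0 : ℝ)..x, K (max (x - r) 0 + e) * g r) :
    -(D - K (T + e) / K e * (D - m)) ≤ ∫ r in (0 : ℝ)..x, K (max (t - r) 0 + e) * g r := by
  set φ : ℝ → ℝ := fun r => K (max (x - r) 0 + e) * g r with hφ
  have hφc : Continuous φ :=
    ((hK.continuous_shift he).comp (continuous_const.sub continuous_id)).mul hg
  set v : ℝ → ℝ := fun s => ∫ r in (0 : ℝ)..s, φ r with hv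
  set q : ℝ → ℝ := fun s => K (t - s + e) / K (x - s + e) with hq
  set q' : ℝ → ℝ := fun s => (-deriv K (t - s + e) * K (x - s + e)
    + K (t - s + e) * deriv K (x - s + e)) / K (x - s + e) ^ 2 with hq'
  have hu : uIcc 0 x = Icc 0 x := uIcc_of_le hx
  have hxs : ∀ s ∈ Icc 0 x, 0 < x - s + e := fun s hs => by have := hs.2; linarith
  have hts : ∀ s ∈ Icc 0 x, 0 < t - s + e := fun s hs => by have := hs.2; linarith
  have hqd : ∀ s ∈ uIcc 0 x, HasDerivAt q (q' s) s := by
    intro s hs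
    rw [hu] at hs
    have h1 : HasDerivAt (fun s => K (t - s + e)) (deriv K (t - s + e) * (-1)) s := by
      have h2 : HasDerivAt (fun s : ℝ => t - s + e) (-1) s := by
        simpa using ((hasDerivAt_id s).const_sub t).add_const e
      exact ((hK.diff _ (hts s hs)).hasDerivAt).comp s h2
    have h1' : HasDerivAt (fun s => K (x - s + e)) (deriv K (x - s + e) * (-1)) s := by
      have h2 : HasDerivAt (fun s : ℝ => x - s + e) (-1) s := by
        simpa using ((hasDerivAt_id s).const_sub x).add_const e
      exact ((hK.diff _ (hxs s hs)).hasDerivAt).comp s h2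
    refine (h1.div h1' (hK.pos _ (hxs s hs)).ne').congr_deriv ?_
    simp only [hq']; ring
  have hvd : ∀ s ∈ uIcc 0 x, HasDerivAt v (φ s) s := fun s _ =>
    (hφc.integral_hasStrictDerivAt 0 s).hasDerivAt
  have hq'c : ContinuousOn q' (Icc 0 x) := by
    have m1 : MapsTo (fun s => t - s + e) (Icc 0 x) (Ioi 0) := hts
    have m2 : MapsTo (fun s => x - s + e) (Icc 0 x) (Ioi 0) := hxs
    have c1 := hK.cont_deriv.comp (f := fun s => t - s + e) (by fun_prop) m1
    have c2 := hK.cont_deriv.comp (f := fun s => x - s + e) (by fun_prop) m2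
    have c3 := hK.continuousOn.comp (f := fun s => t - s + e) (by fun_prop) m1
    have c4 := hK.continuousOn.comp (f := fun s => x - s + e) (by fun_prop) m2
    exact ((c1.neg.mul c4).add (c3.mul c2)).div (c4.pow 2)
      (fun s hs => pow_ne_zero 2 (hK.pos _ (hxs s hs)).ne')
  have hq'i : IntervalIntegrable q' volume 0 x := by
    apply ContinuousOn.intervalIntegrable; rwa [hu]
  have hφi : IntervalIntegrable φ volume 0 x := hφc.intervalIntegrable _ _
  have hvc : Continuous v := intervalIntegral.continuous_primitive
    (fun a b => hφc.intervalIntegrable a b) 0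
  have hparts := intervalIntegral.integral_mul_deriv_eq_deriv_mul hqd hvd hq'i hφi
  have hJt : (∫ r in (0 : ℝ)..x, K (max (t - r) 0 + e) * g r) = ∫ r in (0 : ℝ)..x, q r * φ r := by
    apply intervalIntegral.integral_congr
    intro r hr
    rw [hu] at hr
    have h1 := hxs r hr
    have := hr.2
    simp only [hq, hφ]
    rw [max_eq_left (by linarith), max_eq_left (by linarith)]
    field_simp [(hK.pos _ h1).ne']
  -- This is log-convexity: `K'/K` is nondecreasing, and `x - s + e ≤ t - s + e`.
  have hq'0 : ∀ s ∈ Icc 0 x, q' s ≤ 0 := by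
    intro s hs
    apply div_nonpos_of_nonpos_of_nonneg _ (sq_nonneg _)
    have := hK.ratio (x - s + e) (t - s + e) (hxs s hs) (by linarith)
    linarith
  have hint : -(D * (q 0 - q x)) ≤ -∫ s in (0 : ℝ)..x, q' s * v s := by
    have e1 : ∫ s in (0 : ℝ)..x, q' s = q x - q 0 :=
      intervalIntegral.integral_eq_sub_of_hasDerivAt hqd hq'i
    have e2 : ∫ s in (0 : ℝ)..x, q' s * v s ≤ ∫ s in (0 : ℝ)..x, q' s * (-D) := by
      apply intervalIntegral.integral_mono_on hx
      · apply ContinuousOn.intervalIntegrable; rw [hu]; exact hq'c.mul hvc.continuousOn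
      · exact hq'i.mul_const _
      · intro s hs
        exact mul_le_mul_of_nonpos_left (hJ s hs) (hq'0 s hs)
    rw [intervalIntegral.integral_mul_const, e1] at e2
    linarith
  have hv0 : v 0 = 0 := by simp [hv]
  rw [hJt, hparts, hv0]
  have hq0 : q 0 ≤ 1 := by
    simp only [hq]
    rw [div_le_one (hK.pos _ (by linarith))]
    exact hK.anti (by linarith) (by linarith)
  have hqx : K (T + e) / K e ≤ q x := by
    simp only [hq, sub_self, zero_add]
    gcongr
    · exact (hK.pos _ he).le
    · exact hK.anti (by linarith) (by linarith)
  have hqx0 : 0 ≤ q x := le_trans (div_nonneg (hK.pos _ (by linarith)).le (hK.pos _ he).le) hqx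
  have h1 : q x * (-m) ≤ q x * v x := mul_le_mul_of_nonneg_left hm hqx0
  nlinarith [mul_le_mul_of_nonneg_right hqx (sub_nonneg.2 hmD), mul_le_mul_of_nonneg_left hq0 hD]

/-- `shift_step` assumes a bound of the same kind as the one it yields, so it is iterated from a
crude bound `D0`. The excess over `m` shrinks by `1 - θ` in each round and vanishes in the limit.
The shift `e > 0` makes `K e` finite, hence `θ > 0`. -/
lemma shift_bound (hK : LogConvexKernel K) {e : ℝ} (he : 0 < e) {g : ℝ → ℝ} (hg : Continuous g)
    {X T m : ℝ} (hXT : X ≤ T) (hm : 0 ≤ m)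
    (hy : ∀ x ∈ Icc 0 X, -m ≤ ∫ r in (0 : ℝ)..x, K (max (x - r) 0 + e) * g r) :
    ∀ x ∈ Icc 0 X, ∀ t ∈ Icc x T, -m ≤ ∫ r in (0 : ℝ)..x, K (max (t - r) 0 + e) * g r := by
  intro x0 hx0 t0 ht0
  have hT : 0 ≤ T := hx0.1.trans (hx0.2.trans hXT)
  obtain ⟨B, hB⟩ := (isCompact_Icc (a := (0 : ℝ)) (b := T)).exists_bound_of_continuousOn
    hg.continuousOn
  have hB0 : 0 ≤ B := (norm_nonneg _).trans (hB 0 ⟨le_rfl, hT⟩)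
  set θ := K (T + e) / K e with hθ
  have hKe := hK.pos e he
  have hθ0 : 0 < θ := div_pos (hK.pos _ (by linarith)) hKe
  have hθ1 : θ ≤ 1 := by rw [hθ, div_le_one hKe]; exact hK.anti he (by linarith)
  set D0 := K e * B * T with hD0
  have hD0n : 0 ≤ D0 := by positivity
  have key : ∀ k : ℕ, ∀ x ∈ Icc 0 X, ∀ t ∈ Icc x T,
      -(m + (1 - θ) ^ k * D0) ≤ ∫ r in (0 : ℝ)..x, K (max (t - r) 0 + e) * g r := by
    intro k
    induction k with
    | zero =>
      intro x hx t ht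
      have h1 : ‖∫ r in (0 : ℝ)..x, K (max (t - r) 0 + e) * g r‖ ≤ K e * B * |x - 0| := by
        apply intervalIntegral.norm_integral_le_of_norm_le_const
        intro r hr
        rw [uIoc_of_le hx.1] at hr
        rw [norm_mul]
        have hp := hK.pos (max (t - r) 0 + e) (by positivity)
        have := hB r ⟨hr.1.le, hr.2.trans (hx.2.trans hXT)⟩
        rw [Real.norm_of_nonneg hp.le]
        gcongr
        exact hK.anti he (by have := le_max_right (t - r) 0; linarith)
      rw [sub_zero, abs_of_nonneg hx.1] at h1
      have h2 : K e * B * x ≤ D0 := by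
        rw [hD0]; gcongr; exact hx.2.trans hXT
      have h3 := (abs_le.1 (Real.norm_eq_abs _ ▸ h1)).1
      rw [pow_zero, one_mul]
      linarith
    | succ k ih =>
      intro x hx t ht
      have h0 : 0 ≤ (1 - θ) ^ k * D0 := mul_nonneg (pow_nonneg (by linarith) k) hD0n
      have := hK.shift_step he hg hx.1 ht.1 ht.2 (m := m) (D := m + (1 - θ) ^ k * D0)
        (by linarith)
        (fun s hs => ih s ⟨hs.1, hs.2.trans hx.2⟩ x ⟨hs.2, hx.2.trans hXT⟩) (by linarith) (hy x hx)
      refine le_trans (le_of_eq ?_) this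
      rw [← hθ]; ring
  have hlim : Tendsto (fun k : ℕ => -(m + (1 - θ) ^ k * D0)) atTop (𝓝 (-(m + 0 * D0))) :=
    (((tendsto_pow_atTop_nhds_zero_of_lt_one (by linarith) (by linarith)).mul_const D0).const_add
      m).neg
  have := le_of_tendsto hlim (Eventually.of_forall fun k => key k x0 hx0 t0 ht0)
  simpa using this

lemma integrable_conv (hK : LogConvexKernel K) {g : ℝ → ℝ} (hg : Continuous g) {x t : ℝ}
    (hx : 0 ≤ x) (hxt : x ≤ t) :
    IntervalIntegrable (fun r => K (t - r) * g r) volume 0 x := by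
  apply IntervalIntegrable.mul_continuousOn _ hg.continuousOn
  have h1 := (hK.integrable t).comp_sub_left t
  simp only [sub_zero, sub_self] at h1
  apply h1.symm.mono_set
  rw [uIcc_of_le hx, uIcc_of_le (hx.trans hxt)]
  exact Icc_subset_Icc le_rfl hxt

lemma integrable_shift (hK : LogConvexKernel K) {e : ℝ} (he : 0 < e) {g : ℝ → ℝ}
    (hg : Continuous g) (x t : ℝ) :
    IntervalIntegrable (fun r => K (max (t - r) 0 + e) * g r) volume 0 x :=
  (((hK.continuous_shift he).comp (continuous_const.sub continuous_id)).mul hg).intervalIntegrable _ _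

/-- By monotonicity of `K` the change of kernel has a sign, so its integral telescopes to a
difference of integrals of `K` over `[0, e]` and `[t, t + e]`; the latter is nonnegative. The bound
tends to zero with `e`, uniformly in `x` and `t`. -/
lemma shift_error (hK : LogConvexKernel K) {e : ℝ} (he : 0 < e) {g : ℝ → ℝ} (hg : Continuous g)
    {x t B : ℝ} (hx : 0 ≤ x) (hxt : x ≤ t) (hB : ∀ s ∈ Icc 0 x, |g s| ≤ B) :
    |(∫ r in (0 : ℝ)..x, K (t - r) * g r) - ∫ r in (0 : ℝ)..x, K (max (t - r) 0 + e) * g r| ≤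
      B * ∫ u in (0 : ℝ)..e, K u := by
  have hB0 : 0 ≤ B := (abs_nonneg _).trans (hB 0 ⟨le_rfl, hx⟩)
  have ht : 0 ≤ t := hx.trans hxt
  rw [← intervalIntegral.integral_sub (hK.integrable_conv hg hx hxt) (hK.integrable_shift he hg x t)]
  have hone : Continuous fun _ : ℝ => (1 : ℝ) := continuous_const
  have i1 := hK.integrable_conv hone ht le_rfl
  have i2 := hK.integrable_shift he hone t t
  simp only [mul_one] at i1 i2
  have i1x := hK.integrable_conv hone hx hxt
  have i2x := hK.integrable_shift he hone x t
  simp only [mul_one] at i1x i2x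
  have hpw : ∀ r, r < t → 0 ≤ K (t - r) - K (max (t - r) 0 + e) := by
    intro r hr
    have h1 : 0 < t - r := by linarith
    rw [max_eq_left h1.le]
    linarith [hK.anti h1 (by linarith : t - r ≤ t - r + e)]
  have step1 : ‖∫ r in (0 : ℝ)..x, (K (t - r) * g r - K (max (t - r) 0 + e) * g r)‖ ≤
      ∫ r in (0 : ℝ)..x, (K (t - r) - K (max (t - r) 0 + e)) * B := by
    apply intervalIntegral.norm_integral_le_of_norm_le hx
    · have hne : ∀ᵐ r : ℝ, r ≠ t := by simp [ae_iff, measure_singleton]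
      filter_upwards [hne] with r hr hrx
      have := hpw r (lt_of_le_of_ne (hrx.2.trans hxt) hr)
      rw [← sub_mul, norm_mul, Real.norm_of_nonneg this]
      gcongr
      exact hB r ⟨hrx.1.le, hrx.2⟩
    · exact (i1x.sub i2x).mul_const B
  rw [← Real.norm_eq_abs]
  refine step1.trans ?_
  rw [intervalIntegral.integral_mul_const, mul_comm]
  gcongr
  calc ∫ r in (0 : ℝ)..x, (K (t - r) - K (max (t - r) 0 + e))
      ≤ ∫ r in (0 : ℝ)..t, (K (t - r) - K (max (t - r) 0 + e)) := by
        apply intervalIntegral.integral_mono_interval le_rfl hx hxt _ (i1.sub i2)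
        have hne : ∀ᵐ r ∂volume.restrict (Ioc 0 t), r ≠ t :=
          ae_restrict_of_ae (by simp [ae_iff, measure_singleton])
        filter_upwards [hne, ae_restrict_mem measurableSet_Ioc] with r hr hrx
        exact hpw r (lt_of_le_of_ne hrx.2 hr)
    _ = (∫ u in (0 : ℝ)..t, K u) - ∫ u in e..(t + e), K u := by
        rw [intervalIntegral.integral_sub i1 i2]
        congr 1
        · simp [intervalIntegral.integral_comp_sub_left (fun u => K u) t]
        · have : (∫ r in (0 : ℝ)..t, K (max (t - r) 0 + e)) =
              ∫ r in (0 : ℝ)..t, K (t + e - r) := by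
            apply intervalIntegral.integral_congr
            intro r hr
            rw [uIcc_of_le ht] at hr
            have := hr.2
            simp only
            rw [max_eq_left (by linarith)]
            congr 1; ring
          rw [this, intervalIntegral.integral_comp_sub_left (fun u => K u) (t + e)]
          simp
    _ ≤ ∫ u in (0 : ℝ)..e, K u := by
        have a1 := hK.integrable t
        have a2 := hK.integrable e
        have a3 := hK.integrable (t + e)
        have e1 := intervalIntegral.integral_interval_sub_left a3 a2
        have e2 := intervalIntegral.integral_interval_sub_left a3 a1
        have : 0 ≤ ∫ u in t..(t + e), K u := by
          apply intervalIntegral.integral_nonneg_of_ae_restrict (by linarith)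
          have hne : ∀ᵐ r ∂volume.restrict (Icc t (t + e)), r ≠ 0 :=
            ae_restrict_of_ae (by simp [ae_iff, measure_singleton])
          filter_upwards [hne, ae_restrict_mem measurableSet_Icc] with r hr hrx
          exact (hK.pos r (lt_of_le_of_ne (ht.trans hrx.1) hr.symm)).le
        linarith

/-- If `K * g ≥ -m` on `[0, x]`, then continuing by zero forcing after `x` keeps the bound. -/
lemma truncated_conv_ge (hK : LogConvexKernel K) {g : ℝ → ℝ} (hg : Continuous g)
    {x t m : ℝ} (hx : 0 ≤ x) (hxt : x ≤ t) (hm : 0 ≤ m)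
    (hy : ∀ s ∈ Icc 0 x, -m ≤ ∫ r in (0 : ℝ)..s, K (s - r) * g r) :
    -m ≤ ∫ r in (0 : ℝ)..x, K (t - r) * g r := by
  obtain ⟨B, hB⟩ := (isCompact_Icc (a := (0 : ℝ)) (b := x)).exists_bound_of_continuousOn
    hg.continuousOn
  have hB0 : 0 ≤ B := (norm_nonneg _).trans (hB 0 ⟨le_rfl, hx⟩)
  set P : ℝ → ℝ := fun e => ∫ u in (0 : ℝ)..e, K u with hP
  have hPc : Continuous P := by
    apply intervalIntegral.continuous_primitive
    intro a b
    exact (hK.integrable a).symm.trans (hK.integrable b)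
  -- The shift error is paid twice: to transfer the hypothesis to the shifted kernel, and to return
  -- to `K`.
  have key : ∀ e, 0 < e → -m - 2 * (B * P e) ≤ ∫ r in (0 : ℝ)..x, K (t - r) * g r := by
    intro e he
    have hPe : 0 ≤ P e := by
      apply intervalIntegral.integral_nonneg_of_ae_restrict he.le
      have hne : ∀ᵐ r ∂volume.restrict (Icc 0 e), r ≠ 0 :=
        ae_restrict_of_ae (by simp [ae_iff, measure_singleton])
      filter_upwards [hne, ae_restrict_mem measurableSet_Icc] with r hr hrx
      exact (hK.pos r (lt_of_le_of_ne hrx.1 hr.symm)).le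
    have h1 := hK.shift_bound he hg (T := t) (X := x) hxt (m := m + B * P e) (by positivity)
      (by
        intro s hs
        have h2 := hK.shift_error he hg hs.1 le_rfl (B := B)
          (fun r hr => hB r ⟨hr.1, hr.2.trans hs.2⟩)
        have h3 := hy s hs
        have := (abs_le.1 h2).2
        simp only [hP]
        linarith) x ⟨hx, le_rfl⟩ t ⟨hxt, le_rfl⟩
    have h2 := hK.shift_error he hg hx hxt (B := B) hB
    have := (abs_le.1 h2).1
    simp only [hP] at *
    linarith
  have hlim : Tendsto (fun e => -m - 2 * (B * P e)) (𝓝[>] 0) (𝓝 (-m - 2 * (B * P 0))) :=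
    ((continuous_const.sub (continuous_const.mul (continuous_const.mul hPc))).tendsto 0).mono_left
      nhdsWithin_le_nhds
  have := le_of_tendsto hlim (by filter_upwards [self_mem_nhdsWithin] with e he using key e he)
  simpa [hP] using this

/-- At a point where `d = d₀ + K * p ≥ 0` first vanishes, the forcing `p` is not positive. -/
lemma forcing_nonpos_of_touch (hK : LogConvexKernel K) {p d : ℝ → ℝ} {T d0 t1 : ℝ}
    (hp : ContinuousOn p (Icc 0 T)) (hd0 : 0 ≤ d0)
    (hd : ∀ t ∈ Icc 0 T, d t = d0 + ∫ s in (0 : ℝ)..t, K (t - s) * p s)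
    (ht1 : 0 < t1) (ht1T : t1 ≤ T) (hpos : ∀ t ∈ Icc 0 t1, 0 ≤ d t) (hz : d t1 = 0) :
    p t1 ≤ 0 := by
  by_contra hcon
  push Not at hcon
  have hT : 0 ≤ T := ht1.le.trans ht1T
  set g : ℝ → ℝ := IccExtend hT ((Icc 0 T).domRestrict p) with hgdef
  have hg : Continuous g := continuous_IccExtend_iff.2 hp.domRestrict
  have hgp : ∀ s ∈ Icc 0 T, g s = p s := by
    intro s hs; rw [hgdef, IccExtend_of_mem _ _ hs]; rfl
  have hd' : ∀ t ∈ Icc 0 T, d t = d0 + ∫ s in (0 : ℝ)..t, K (t - s) * g s := by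
    intro t ht
    rw [hd t ht]
    congr 1
    apply intervalIntegral.integral_congr
    intro s hs
    rw [uIcc_of_le ht.1] at hs
    simp only
    rw [hgp s ⟨hs.1, hs.2.trans ht.2⟩]
  have hg1 : 0 < g t1 := by rw [hgp t1 ⟨ht1.le, ht1T⟩]; exact hcon
  -- If the forcing were positive at `t1`, it would be positive on some `[t0, t1]`. The part before
  -- `t0` contributes at least `-d0` by truncation and the rest is strictly positive, so `d t1 > 0`.
  obtain ⟨δ, hδ, hball⟩ := Metric.eventually_nhds_iff.1
    (hg.continuousAt.eventually (lt_mem_nhds hg1) : ∀ᶠ s in 𝓝 t1, 0 < g s)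
  set t0 := max 0 (t1 - δ / 2) with ht0
  have h0 : 0 ≤ t0 := le_max_left _ _
  have h01 : t0 < t1 := max_lt ht1 (by linarith)
  have hgpos : ∀ s ∈ Icc t0 t1, 0 < g s := by
    intro s hs
    apply hball
    rw [Real.dist_eq, abs_lt]
    have := (le_max_right 0 (t1 - δ / 2)).trans hs.1
    constructor <;> linarith [hs.2]
  have h1 : -d0 ≤ ∫ r in (0 : ℝ)..t0, K (t1 - r) * g r := by
    apply hK.truncated_conv_ge hg h0 h01.le hd0
    intro s hs
    have := hpos s ⟨hs.1, hs.2.trans h01.le⟩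
    rw [hd' s ⟨hs.1, hs.2.trans (h01.le.trans ht1T)⟩] at this
    linarith
  have i1 := hK.integrable_conv hg ht1.le le_rfl
  have i0 := hK.integrable_conv hg h0 h01.le
  have i2 : IntervalIntegrable (fun r => K (t1 - r) * g r) volume t0 t1 := i0.symm.trans i1
  have h2 : 0 < ∫ r in t0..t1, K (t1 - r) * g r := by
    apply intervalIntegral.intervalIntegral_pos_of_pos_on i2 _ h01
    intro r hr
    exact mul_pos (hK.pos _ (by linarith [hr.2])) (hgpos r ⟨hr.1.le, hr.2.le⟩)
  have h3 := intervalIntegral.integral_add_adjacent_intervals i0 i2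
  have h4 := hd' t1 ⟨ht1.le, ht1T⟩
  linarith

end LogConvexKernel

end RoughHeston

/-! ### Supersolutions and comparison principles. -/

namespace RoughHeston

namespace LogConvexKernel

variable {K : ℝ → ℝ}

lemma integrable_exp (hK : LogConvexKernel K) (θ a b : ℝ) :
    IntervalIntegrable (fun u => K u * Real.exp (-(θ * u))) volume a b :=
  ((hK.integrable a).symm.trans (hK.integrable b)).mul_continuousOn (by fun_prop)

/-- The bound tends to zero as `θ → ∞` and sees `K` only through `C0`; this allows one choice of `θ`
for all dominated kernels. -/
lemma laplace_le (hK : LogConvexKernel K) {H T C0 θ : ℝ} (hH : 0 < H) (hC0 : 0 ≤ C0) (hθ : 0 < θ)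
    (hb : ∀ t ∈ Ioc 0 T, K t ≤ C0 * t ^ (H - 1 / 2)) {t : ℝ} (ht : t ∈ Icc 0 T) :
    ∫ u in (0 : ℝ)..t, K u * Real.exp (-(θ * u)) ≤
      C0 * ((1 / θ) ^ (H + 1 / 2) * Real.Gamma (H + 1 / 2)) := by
  have hI := Real.integral_rpow_mul_exp_neg_mul_Ioi (a := H + 1 / 2) (r := θ) (by linarith) hθ
  have e1 : H + 1 / 2 - 1 = H - 1 / 2 := by ring
  rw [e1] at hI
  have hG : 0 < (1 / θ) ^ (H + 1 / 2) * Real.Gamma (H + 1 / 2) :=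
    mul_pos (Real.rpow_pos_of_pos (by positivity) _) (Real.Gamma_pos_of_pos (by linarith))
  have hint : IntegrableOn (fun u : ℝ => u ^ (H - 1 / 2) * Real.exp (-(θ * u))) (Ioi 0) := by
    -- A non-integrable function would have integral `0`, whereas the Gamma value is positive.
    by_contra hcon
    rw [integral_undef hcon] at hI
    linarith
  rw [← hI, ← MeasureTheory.integral_const_mul, intervalIntegral.integral_of_le ht.1]
  calc ∫ u in Ioc 0 t, K u * Real.exp (-(θ * u))
      ≤ ∫ u in Ioc 0 t, C0 * (u ^ (H - 1 / 2) * Real.exp (-(θ * u))) := by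
        apply setIntegral_mono_on
        · exact (intervalIntegrable_iff_integrableOn_Ioc_of_le ht.1).1 (hK.integrable_exp θ 0 t)
        · exact (hint.mono_set Ioc_subset_Ioi_self).const_mul _
        · exact measurableSet_Ioc
        · intro u hu
          rw [← mul_assoc]
          gcongr
          exact hb u ⟨hu.1, hu.2.trans ht.2⟩
    _ ≤ _ := by
        apply setIntegral_mono_set (hint.const_mul _)
        · filter_upwards [ae_restrict_mem measurableSet_Ioi] with u hu
          have : (0 : ℝ) < u := hu
          positivity
        · exact Ioc_subset_Ioi_self.eventuallyLE

/-- Strict supersolutions of `l = 1 + K * (C l)`, bounded uniformly over dominated kernels. -/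
lemma exists_supersolution {H T C0 C : ℝ} (hH : 0 < H) (hC0 : 0 ≤ C0) (hC : 0 ≤ C) :
    ∃ B : ℝ, ∀ K : ℝ → ℝ, LogConvexKernel K → (∀ t ∈ Ioc 0 T, K t ≤ C0 * t ^ (H - 1 / 2)) →
      ∃ l f : ℝ → ℝ, Continuous l ∧ Continuous f ∧
        (∀ t, l t = 1 + ∫ s in (0 : ℝ)..t, K (t - s) * f s) ∧
        ∀ t ∈ Icc 0 T, 1 ≤ l t ∧ l t ≤ B ∧ C * l t < f t := by
  set Γ' := Real.Gamma (H + 1 / 2) with hΓ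
  have hΓ0 : 0 < Γ' := Real.Gamma_pos_of_pos (by linarith)
  have hlim : Tendsto (fun θ : ℝ => C * (C0 * ((1 / θ) ^ (H + 1 / 2) * Γ'))) atTop (𝓝 0) := by
    have h1 : Tendsto (fun θ : ℝ => θ ^ (-(H + 1 / 2))) atTop (𝓝 0) :=
      tendsto_rpow_neg_atTop (by linarith)
    have h2 : Tendsto (fun θ : ℝ => C * (C0 * (θ ^ (-(H + 1 / 2)) * Γ'))) atTop
        (𝓝 (C * (C0 * (0 * Γ')))) := ((h1.mul_const _).const_mul _).const_mul _
    simp only [zero_mul, mul_zero] at h2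
    refine h2.congr' ?_
    filter_upwards [eventually_gt_atTop 0] with θ hθ
    rw [one_div θ, Real.inv_rpow hθ.le, Real.rpow_neg hθ.le]
  obtain ⟨θ, hθ0, hθ⟩ := ((eventually_gt_atTop 0).and
    (hlim.eventually (gt_mem_nhds (by norm_num : (0 : ℝ) < 1 / 2)))).exists
  set κ := C0 * ((1 / θ) ^ (H + 1 / 2) * Γ') with hκ
  have hκ0 : 0 ≤ κ := by positivity
  refine ⟨1 + (2 * C + 1) * Real.exp (θ * T) * κ, fun K hK hb => ?_⟩
  set P : ℝ → ℝ := fun t => ∫ u in (0 : ℝ)..t, K u * Real.exp (-(θ * u)) with hP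
  have hPc : Continuous P := intervalIntegral.continuous_primitive (hK.integrable_exp θ) 0
  -- The forcing is `f = (2C+1) e^(θt)`, so that `l = 1 + e^(θt) (2C+1) P`. As `C P ≤ 1/2`, one gets
  -- `C l ≤ C + f/2`, and `C < f/2` because `f ≥ 2C+1`.
  refine ⟨fun t => 1 + (2 * C + 1) * Real.exp (θ * t) * P t,
    fun t => (2 * C + 1) * Real.exp (θ * t), by fun_prop, by fun_prop, ?_, ?_⟩
  · intro t
    simp only [hP]
    congr 1
    have := intervalIntegral.integral_comp_sub_left
      (fun u => K u * Real.exp (-(θ * u))) t (a := 0) (b := t)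
    simp only [sub_zero, sub_self] at this
    rw [← this, ← intervalIntegral.integral_const_mul]
    apply intervalIntegral.integral_congr
    intro s _
    simp only
    rw [show Real.exp (θ * s) = Real.exp (θ * t) * Real.exp (-(θ * (t - s))) by
      rw [← Real.exp_add]; congr 1; ring]
    ring
  · intro t ht
    have hP0 : 0 ≤ P t := by
      apply intervalIntegral.integral_nonneg_of_ae_restrict ht.1
      have hne : ∀ᵐ r ∂volume.restrict (Icc 0 t), r ≠ 0 :=
        ae_restrict_of_ae (by simp [ae_iff, measure_singleton])
      filter_upwards [hne, ae_restrict_mem measurableSet_Icc] with r hr hrx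
      exact mul_nonneg (hK.pos r (lt_of_le_of_ne hrx.1 hr.symm)).le (Real.exp_pos _).le
    have hPκ : P t ≤ κ := hK.laplace_le hH hC0 hθ0 hb ht
    have he : 1 ≤ Real.exp (θ * t) := Real.one_le_exp (mul_nonneg hθ0.le ht.1)
    have heT : Real.exp (θ * t) ≤ Real.exp (θ * T) :=
      Real.exp_le_exp.2 (mul_le_mul_of_nonneg_left ht.2 hθ0.le)
    refine ⟨?_, ?_, ?_⟩
    · have : 0 ≤ (2 * C + 1) * Real.exp (θ * t) * P t := by positivity
      linarith
    · have h3 : Real.exp (θ * t) * P t ≤ Real.exp (θ * T) * κ := by gcongr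
      have := mul_le_mul_of_nonneg_left h3 (by linarith : 0 ≤ 2 * C + 1)
      simp only [mul_assoc] at this ⊢
      linarith
    · have hCP : C * P t ≤ 1 / 2 := (mul_le_mul_of_nonneg_left hPκ hC).trans hθ.le
      have := mul_le_mul_of_nonneg_left hCP
        (by positivity : 0 ≤ (2 * C + 1) * Real.exp (θ * t))
      have h3 : (2 * C + 1) * 1 ≤ (2 * C + 1) * Real.exp (θ * t) := by gcongr
      nlinarith

lemma integrable_conv_complex (hK : LogConvexKernel K) {g : ℝ → ℂ} {T t : ℝ}
    (hg : ContinuousOn g (Icc 0 T)) (ht : t ∈ Icc 0 T) :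
    IntervalIntegrable (fun s => (K (t - s) : ℂ) * g s) volume 0 t := by
  apply IntervalIntegrable.mul_continuousOn
  · have h1 := (hK.integrable t).comp_sub_left t
    simp only [sub_zero, sub_self] at h1
    exact ⟨h1.symm.1.ofReal, h1.symm.2.ofReal⟩
  · rw [uIcc_of_le ht.1]
    exact hg.mono (Icc_subset_Icc le_rfl ht.2)

lemma re_conv (hK : LogConvexKernel K) {g : ℝ → ℂ} {T t : ℝ}
    (hg : ContinuousOn g (Icc 0 T)) (ht : t ∈ Icc 0 T) (e : ℂ) :
    (e * ∫ s in (0 : ℝ)..t, (K (t - s) : ℂ) * g s).re =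
      ∫ s in (0 : ℝ)..t, K (t - s) * (e * g s).re := by
  have := ContinuousLinearMap.intervalIntegral_comp_comm
    (Complex.reCLM.comp (ContinuousLinearMap.mul ℝ ℂ e)) (hK.integrable_conv_complex hg ht)
  simp only [ContinuousLinearMap.comp_apply, ContinuousLinearMap.mul_apply',
    Complex.reCLM_apply] at this
  rw [← this]
  apply intervalIntegral.integral_congr
  intro s _
  simp only
  rw [mul_left_comm, Complex.re_ofReal_mul]

lemma integrable_conv_on (hK : LogConvexKernel K) {g : ℝ → ℝ} {T t : ℝ}
    (hg : ContinuousOn g (Icc 0 T)) (ht : t ∈ Icc 0 T) :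
    IntervalIntegrable (fun s => K (t - s) * g s) volume 0 t := by
  apply IntervalIntegrable.mul_continuousOn
  · have h1 := (hK.integrable t).comp_sub_left t
    simp only [sub_zero, sub_self] at h1
    exact h1.symm
  · rw [uIcc_of_le ht.1]
    exact hg.mono (Icc_subset_Icc le_rfl ht.2)

lemma conv_linear (hK : LogConvexKernel K) {f g : ℝ → ℝ} {T t : ℝ}
    (hf : Continuous f) (hg : ContinuousOn g (Icc 0 T)) (ht : t ∈ Icc 0 T) (a : ℝ) :
    ∫ s in (0 : ℝ)..t, K (t - s) * (a * f s - g s) =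
      a * (∫ s in (0 : ℝ)..t, K (t - s) * f s) - ∫ s in (0 : ℝ)..t, K (t - s) * g s := by
  rw [← intervalIntegral.integral_const_mul, ← intervalIntegral.integral_sub
    ((hK.integrable_conv_on (T := T) hf.continuousOn ht).const_mul a)
    (hK.integrable_conv_on hg ht)]
  apply intervalIntegral.integral_congr
  intro s _
  simp only
  ring

/-- Comparison principle for the modulus, uniform over dominated log-convex kernels. -/
lemma norm_le_of_comparison {H T C0 C : ℝ} (hH : 0 < H) (hC0 : 0 ≤ C0) (hC : 0 ≤ C) :
    ∃ B : ℝ, 0 < B ∧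
      ∀ K : ℝ → ℝ, LogConvexKernel K → (∀ t ∈ Ioc 0 T, K t ≤ C0 * t ^ (H - 1 / 2)) →
      ∀ (h g : ℝ → ℂ) (h0 : ℂ) (R : ℝ), 0 < R → ‖h0‖ ≤ R → ContinuousOn h (Icc 0 T) →
      ContinuousOn g (Icc 0 T) →
      (∀ t ∈ Icc 0 T, h t = h0 + ∫ s in (0 : ℝ)..t, (K (t - s) : ℂ) * g s) →
      (∀ s ∈ Icc 0 T, R ≤ ‖h s‖ → ((starRingEnd ℂ) (h s) * g s).re ≤ C * ‖h s‖ ^ 2) →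
      ∀ t ∈ Icc 0 T, ‖h t‖ ≤ B * R := by
  obtain ⟨B, hB⟩ := exists_supersolution (T := T) hH hC0 hC
  refine ⟨2 * max B 1, by positivity, fun K hK hb h g h0 R hR hh0 hh hg hsol hcomp t ht => ?_⟩
  obtain ⟨l, f, hl, hf, hlf, hlB⟩ := hB K hK hb
  have hl0 : ∀ t ∈ Icc 0 T, l t ≠ 0 := fun t ht => by have := (hlB t ht).1; linarith
  -- The smallest multiple `κ l` above `‖h‖` touches it at `t1`; everything reduces to bounding `κ`.
  obtain ⟨t1, ht1, hmax⟩ := isCompact_Icc.exists_isMaxOn ⟨t, ht⟩ (hh.norm.div hl.continuousOn hl0)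
  set κ := ‖h t1‖ / l t1 with hκ
  have hle : ∀ s ∈ Icc 0 T, ‖h s‖ ≤ κ * l s := fun s hs => by
    have h1 : ‖h s‖ / l s ≤ κ := hmax hs
    rwa [div_le_iff₀ (by have := (hlB s hs).1; linarith)] at h1
  have heq : ‖h t1‖ = κ * l t1 := by rw [hκ, div_mul_cancel₀ _ (hl0 t1 ht1)]
  suffices hκR : κ ≤ 2 * R by
    have h1 := hlB t ht
    calc ‖h t‖ ≤ κ * l t := hle t ht
      _ ≤ (2 * R) * max B 1 := by
        gcongr
        · linarith
        · exact h1.2.1.trans (le_max_left _ _)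
      _ = 2 * max B 1 * R := by ring
  by_contra hcon
  push Not at hcon
  have hl1 := hlB t1 ht1
  set n := ‖h t1‖ with hn
  have hnκ : κ ≤ n := by rw [heq]; nlinarith
  have hn0 : 0 < n := by linarith
  -- Projecting onto the direction of `h t1` makes the problem real: `Re (e h) ≤ n ‖h‖`, with
  -- equality at `t1`. The function `κ n l - Re (e h)` is thus nonnegative and vanishes at `t1`,
  -- where its forcing would be positive by the strict supersolution property.
  set e := (starRingEnd ℂ) (h t1) with he
  have hen : ‖e‖ = n := by rw [he, RCLike.norm_conj]
  have hre : ∀ z : ℂ, (e * z).re ≤ n * ‖z‖ := fun z => by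
    rw [← hen, ← norm_mul]; exact Complex.re_le_norm _
  have hgre : ContinuousOn (fun s => (e * g s).re) (Icc 0 T) :=
    Complex.continuous_re.comp_continuousOn (continuousOn_const.mul hg)
  have hd0 : 0 < κ * n - (e * h0).re := by
    have := hre h0
    nlinarith
  have hdeq : ∀ t ∈ Icc 0 T, κ * n * l t - (e * h t).re = (κ * n - (e * h0).re) +
      ∫ s in (0 : ℝ)..t, K (t - s) * (κ * n * f s - (e * g s).re) := by
    intro t ht
    rw [hK.conv_linear hf hgre ht, ← hK.re_conv hg ht, hsol t ht, hlf t, mul_add e,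
      Complex.add_re]
    ring
  have hpos : ∀ t ∈ Icc 0 T, 0 ≤ κ * n * l t - (e * h t).re := by
    intro t ht
    have h1 := hre (h t)
    have h2 := mul_le_mul_of_nonneg_left (hle t ht) hn0.le
    linarith
  have hself : (e * h t1).re = n ^ 2 := by
    rw [he, Complex.conj_mul', hn]
    norm_cast
  have hz : κ * n * l t1 - (e * h t1).re = 0 := by
    rw [hself, sq]
    linear_combination (-n) * heq
  have ht1pos : 0 < t1 := by
    rcases ht1.1.lt_or_eq with h1 | h1
    · exact h1
    · exfalso
      have := hdeq t1 ht1
      rw [hz, ← h1, intervalIntegral.integral_same] at this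
      linarith
  have := hK.forcing_nonpos_of_touch (p := fun s => κ * n * f s - (e * g s).re)
    (d := fun t => κ * n * l t - (e * h t).re) (T := T)
    ((hf.continuousOn.const_mul (κ * n)).sub hgre) hd0.le hdeq ht1pos ht1.2
    (fun s hs => hpos s ⟨hs.1, hs.2.trans ht1.2⟩) hz
  have h4 := hcomp t1 ht1 (by linarith)
  rw [← he, ← hn] at h4
  have h5 : C * n ^ 2 = κ * n * (C * l t1) := by rw [sq]; linear_combination (C * n) * heq
  have h6 : κ * n * (C * l t1) < κ * n * f t1 :=
    mul_lt_mul_of_pos_left hl1.2.2 (mul_pos (by linarith) hn0)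
  linarith

/-- One-sided comparison principle. -/
lemma nonpos_of_comparison {H T C0 C : ℝ} (hH : 0 < H) (hC0 : 0 ≤ C0) (hC : 0 ≤ C)
    (hK : LogConvexKernel K) (hb : ∀ t ∈ Ioc 0 T, K t ≤ C0 * t ^ (H - 1 / 2))
    {y g : ℝ → ℝ} (hy : ContinuousOn y (Icc 0 T)) (hg : ContinuousOn g (Icc 0 T))
    (hsol : ∀ t ∈ Icc 0 T, y t = ∫ s in (0 : ℝ)..t, K (t - s) * g s)
    (hcomp : ∀ s ∈ Icc 0 T, 0 ≤ y s → g s ≤ C * y s) : ∀ t ∈ Icc 0 T, y t ≤ 0 := by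
  intro t ht
  obtain ⟨B, hB⟩ := exists_supersolution (T := T) hH hC0 hC
  obtain ⟨l, f, hl, hf, hlf, hlB⟩ := hB K hK hb
  have hl0 : ∀ t ∈ Icc 0 T, 0 < l t := fun t ht => by have := (hlB t ht).1; linarith
  obtain ⟨t1, ht1, hmax⟩ := isCompact_Icc.exists_isMaxOn ⟨t, ht⟩
    (hy.div hl.continuousOn fun s hs => (hl0 s hs).ne')
  set κ := y t1 / l t1 with hκ
  have hle : ∀ s ∈ Icc 0 T, y s ≤ κ * l s := fun s hs => by
    have h1 : y s / l s ≤ κ := hmax hs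
    rwa [div_le_iff₀ (hl0 s hs)] at h1
  have heq : y t1 = κ * l t1 := by rw [hκ, div_mul_cancel₀ _ (hl0 t1 ht1).ne']
  by_contra hcon
  push Not at hcon
  -- A positive value of `y` somewhere forces the touching multiple to be positive; it then serves
  -- as the initial value `d₀`.
  have hκ0 : 0 < κ := by
    by_contra h1
    push Not at h1
    have := hle t ht
    nlinarith [hl0 t ht]
  have hdeq : ∀ t ∈ Icc 0 T, κ * l t - y t = κ +
      ∫ s in (0 : ℝ)..t, K (t - s) * (κ * f s - g s) := by
    intro t ht
    rw [hK.conv_linear hf hg ht, hsol t ht, hlf t]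
    ring
  have hz : κ * l t1 - y t1 = 0 := by linarith
  have ht1pos : 0 < t1 := by
    rcases ht1.1.lt_or_eq with h1 | h1
    · exact h1
    · exfalso
      have := hdeq t1 ht1
      rw [hz, ← h1, intervalIntegral.integral_same] at this
      linarith
  have := hK.forcing_nonpos_of_touch (p := fun s => κ * f s - g s)
    (d := fun t => κ * l t - y t) (T := T)
    ((hf.continuousOn.const_mul κ).sub hg) hκ0.le hdeq ht1pos ht1.2
    (fun s hs => sub_nonneg.2 (hle s ⟨hs.1, hs.2.trans ht1.2⟩)) hz
  have h4 := hcomp t1 ht1 (by rw [heq]; exact (mul_pos hκ0 (hl0 t1 ht1)).le)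
  have h6 : κ * (C * l t1) < κ * f t1 := mul_lt_mul_of_pos_left (hlB t1 ht1).2.2 hκ0
  have h5 : C * y t1 = κ * (C * l t1) := by rw [heq]; ring
  linarith

end LogConvexKernel

end RoughHeston

/-! ### A priori bounds and stability for the Riccati equation. -/

namespace RoughHeston

lemma riccatiF_re (lam nu rho a b : ℝ) (x : ℂ) :
    (riccatiF lam nu rho ((a : ℂ) + Complex.I * b) x).re = 1 / 2 * (a ^ 2 - b ^ 2 - a) +
      (rho * nu * a - lam) * x.re - rho * nu * b * x.im + nu ^ 2 / 2 * (x.re ^ 2 - x.im ^ 2) := by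
  have h2 : ((1 : ℂ) / 2) = ((1 / 2 : ℝ) : ℂ) := by norm_num
  have h3 : ((nu : ℂ) ^ 2 / 2) = ((nu ^ 2 / 2 : ℝ) : ℂ) := by push_cast; ring
  rw [riccatiF, h2, h3]
  simp [sq, Complex.add_re, Complex.mul_re, Complex.mul_im]
  ring

lemma riccatiF_im (lam nu rho a b : ℝ) (x : ℂ) :
    (riccatiF lam nu rho ((a : ℂ) + Complex.I * b) x).im = 1 / 2 * (2 * a * b - b) +
      (rho * nu * a - lam) * x.im + rho * nu * b * x.re + nu ^ 2 * x.re * x.im := by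
  have h2 : ((1 : ℂ) / 2) = ((1 / 2 : ℝ) : ℂ) := by norm_num
  have h3 : ((nu : ℂ) ^ 2 / 2) = ((nu ^ 2 / 2 : ℝ) : ℂ) := by push_cast; ring
  rw [riccatiF, h2, h3]
  simp [sq, Complex.add_re, Complex.mul_re, Complex.mul_im]
  ring

lemma continuous_riccatiF (lam nu rho : ℝ) (z : ℂ) : Continuous (riccatiF lam nu rho z) := by
  unfold riccatiF; fun_prop

lemma riccatiF_sub (lam nu rho : ℝ) (z x y : ℂ) :
    riccatiF lam nu rho z x - riccatiF lam nu rho z y =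
      ((rho : ℂ) * nu * z - lam + (nu : ℂ) ^ 2 / 2 * (x + y)) * (x - y) := by
  unfold riccatiF; ring

lemma norm_strip_le {a : ℝ} (ha : a ∈ Icc (0 : ℝ) 1) (b : ℝ) :
    ‖(a : ℂ) + Complex.I * b‖ ≤ 1 + |b| := by
  refine (norm_add_le _ _).trans ?_
  simp only [norm_mul, Complex.norm_I, Complex.norm_real, Real.norm_eq_abs, one_mul]
  rw [abs_of_nonneg ha.1]
  linarith [ha.2]

lemma norm_forcing_le {a : ℝ} (ha : a ∈ Icc (0 : ℝ) 1) (b : ℝ) :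
    ‖1 / 2 * (((a : ℂ) + Complex.I * b) ^ 2 - ((a : ℂ) + Complex.I * b))‖ ≤ 2 * (1 + b ^ 2) := by
  set z := (a : ℂ) + Complex.I * b with hz
  have h1 := norm_strip_le ha b
  rw [← hz] at h1
  have h2 : ‖z ^ 2 - z‖ ≤ ‖z‖ ^ 2 + ‖z‖ := by
    refine (norm_sub_le _ _).trans ?_
    rw [norm_pow]
  rw [norm_mul]
  have h3 : ‖(1 : ℂ) / 2‖ = 1 / 2 := by simp
  rw [h3]
  have h4 : ‖z‖ ^ 2 ≤ (1 + |b|) ^ 2 := by gcongr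
  have h5 : |b| ≤ 1 / 2 * (1 + b ^ 2) := by nlinarith [sq_nonneg (|b| - 1), sq_abs b]
  nlinarith [sq_abs b]

section

variable {H T C0 lam nu rho : ℝ} {K : ℝ → ℝ}

/-- In `Re F` the terms without `Re ψ` are `(a² - a)/2` and, after completing the square, `-(ρb + ν
Im ψ)²/2 - (1 - ρ²)b²/2`. All are nonpositive since `a ∈ [0,1]` and `|ρ| ≤ 1`. The remaining terms
carry a factor `Re ψ`, hence are at most linear in it on a compact interval. -/
lemma IsRiccatiSolution.re_nonpos (hH : 0 < H) (hC0 : 0 ≤ C0) (hrho : rho ∈ Icc (-1 : ℝ) 1)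
    (hK : LogConvexKernel K) (hb : ∀ t ∈ Ioc 0 T, K t ≤ C0 * t ^ (H - 1 / 2))
    {a b : ℝ} (ha : a ∈ Icc (0 : ℝ) 1) {psi : ℝ → ℂ}
    (hpsi : IsRiccatiSolution K lam nu rho T ((a : ℂ) + Complex.I * b) psi) :
    ∀ t ∈ Icc 0 T, (psi t).re ≤ 0 := by
  obtain ⟨hc, hs⟩ := hpsi
  have hF : ContinuousOn (fun s => riccatiF lam nu rho ((a : ℂ) + Complex.I * b) (psi s))
      (Icc 0 T) := (continuous_riccatiF _ _ _ _).comp_continuousOn hc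
  obtain ⟨M, hM⟩ := isCompact_Icc.exists_bound_of_continuousOn hc
  rcases lt_or_ge T 0 with hT | hT
  · intro t ht; exact absurd (ht.1.trans ht.2) (not_le.2 hT)
  have hM0 : 0 ≤ M := (norm_nonneg _).trans (hM 0 ⟨le_rfl, hT⟩)
  apply LogConvexKernel.nonpos_of_comparison (C := |rho * nu * a - lam| + nu ^ 2 / 2 * M)
    hH hC0 (by positivity) hK hb (Complex.continuous_re.comp_continuousOn hc)
    (Complex.continuous_re.comp_continuousOn hF)
  · intro t ht
    have := hK.re_conv hF ht 1
    simp only [one_mul] at this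
    change (psi t).re = _
    rw [hs t ht, this]
    rfl
  · intro s hs' hnn
    change (riccatiF lam nu rho ((a : ℂ) + Complex.I * b) (psi s)).re ≤ _ * (psi s).re
    change 0 ≤ (psi s).re at hnn
    rw [riccatiF_re]
    have h1 : (psi s).re ≤ M := (Complex.re_le_norm _).trans (hM s hs')
    have h2 := le_abs_self (rho * nu * a - lam)
    have h3 : 0 ≤ (rho * b + nu * (psi s).im) ^ 2 := sq_nonneg _
    have h4 : rho ^ 2 * b ^ 2 ≤ b ^ 2 := by
      have : rho ^ 2 ≤ 1 := by nlinarith [hrho.1, hrho.2]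
      nlinarith [sq_nonneg b]
    have h5 := mul_le_mul_of_nonneg_right h2 hnn
    have h6 : (psi s).re ^ 2 ≤ M * (psi s).re := by nlinarith
    have h7 := mul_le_mul_of_nonneg_left h6 (by positivity : 0 ≤ nu ^ 2 / 2)
    have h8 : a ^ 2 ≤ a := by nlinarith [ha.1, ha.2]
    nlinarith

/-- The forcing of the rotated solution `χ = ν ψ + i ρ b` is dissipative up to linear growth. -/
lemma rotated_forcing_le (hrho : rho ∈ Icc (-1 : ℝ) 1) {a b : ℝ} (ha : a ∈ Icc (0 : ℝ) 1) {x : ℂ}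
    (hx : x.re ≤ 0)
    (hn : 1 + |b| ≤ ‖(nu : ℂ) * x + Complex.I * (rho * b : ℝ)‖) :
    ((starRingEnd ℂ) ((nu : ℂ) * x + Complex.I * (rho * b : ℝ)) *
      ((nu : ℂ) * riccatiF lam nu rho ((a : ℂ) + Complex.I * b) x)).re ≤
      (3 * |nu| + 2 * |lam|) * ‖(nu : ℂ) * x + Complex.I * (rho * b : ℝ)‖ ^ 2 := by
  set χ := (nu : ℂ) * x + Complex.I * (rho * b : ℝ) with hχ
  have hX : χ.re = nu * x.re := by simp [hχ]
  have hY : χ.im = nu * x.im + rho * b := by simp [hχ]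
  set X := χ.re with hXd
  set Y := χ.im with hYd
  have hnorm : ‖χ‖ ^ 2 = X ^ 2 + Y ^ 2 := by
    rw [Complex.sq_norm, Complex.normSq_apply]; ring
  have hXn : |X| ≤ ‖χ‖ := Complex.abs_re_le_norm χ
  have hYn : |Y| ≤ ‖χ‖ := Complex.abs_im_le_norm χ
  set n := ‖χ‖ with hnd
  have hb0 := abs_nonneg b
  -- The shift by `iρb` absorbs the cross term `ρνzx` of `F` up to its bounded part. The cubic
  -- contribution is `ν² Re x / 2` times a quantity that is nonnegative once `|b| ≤ n`; every other
  -- term is at most a constant times `n²`.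
  have hid : ((starRingEnd ℂ) χ * ((nu : ℂ) * riccatiF lam nu rho ((a : ℂ) + Complex.I * b) x)).re
      = 1 / 2 * (nu * X) * (n ^ 2 - (1 - rho ^ 2) * b ^ 2) + (nu * rho * a - lam) * n ^ 2
        + nu * (1 / 2 * (a ^ 2 - a)) * X
        + (nu * (a * (1 - rho ^ 2) - 1 / 2) + rho * lam) * (b * Y) := by
    rw [hnorm, Complex.mul_re, Complex.re_ofReal_mul, Complex.im_ofReal_mul, riccatiF_re,
      riccatiF_im, Complex.conj_re, Complex.conj_im, ← hXd, ← hYd, hX, hY]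
    ring
  rw [hid]
  have hrho2 : rho ^ 2 ≤ 1 := by nlinarith [hrho.1, hrho.2]
  have habs : |rho| ≤ 1 := abs_le.2 hrho
  have hbn : |b| ≤ n := by linarith
  have hn1 : 1 ≤ n := by linarith
  have hb2 : b ^ 2 ≤ n ^ 2 := by rw [← sq_abs b]; gcongr
  have t1 : 1 / 2 * (nu * X) * (n ^ 2 - (1 - rho ^ 2) * b ^ 2) ≤ 0 := by
    apply mul_nonpos_of_nonpos_of_nonneg
    · rw [hX]
      have := mul_nonneg (sq_nonneg nu) (neg_nonneg.2 hx)
      linarith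
    · have := mul_nonneg (sq_nonneg rho) (sq_nonneg b)
      linarith
  have t2 : (nu * rho * a - lam) * n ^ 2 ≤ (|nu| + |lam|) * n ^ 2 := by
    gcongr
    have : |nu * rho * a| ≤ |nu| := by
      rw [abs_mul, abs_mul, abs_of_nonneg ha.1]
      calc |nu| * |rho| * a ≤ |nu| * 1 * 1 := by gcongr <;> first | exact ha.1 | exact ha.2
        _ = |nu| := by ring
    linarith [le_abs_self (nu * rho * a), neg_abs_le lam]
  have t3 : nu * (1 / 2 * (a ^ 2 - a)) * X ≤ |nu| * n ^ 2 := by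
    refine (le_abs_self _).trans ?_
    rw [abs_mul, abs_mul]
    have : |1 / 2 * (a ^ 2 - a)| ≤ 1 := by
      rw [abs_le]; constructor <;> nlinarith [ha.1, ha.2]
    calc |nu| * |1 / 2 * (a ^ 2 - a)| * |X| ≤ |nu| * 1 * n := by gcongr
      _ ≤ |nu| * n ^ 2 := by
        rw [mul_one]
        gcongr
        nlinarith
  have t4 : (nu * (a * (1 - rho ^ 2) - 1 / 2) + rho * lam) * (b * Y) ≤ (|nu| + |lam|) * n ^ 2 := by
    refine (le_abs_self _).trans ?_
    rw [abs_mul]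
    have e1 : |nu * (a * (1 - rho ^ 2) - 1 / 2) + rho * lam| ≤ |nu| + |lam| := by
      refine (abs_add_le _ _).trans ?_
      rw [abs_mul, abs_mul]
      have h1 : |a * (1 - rho ^ 2) - 1 / 2| ≤ 1 := by
        have u1 : 0 ≤ a * (1 - rho ^ 2) := mul_nonneg ha.1 (sub_nonneg.2 hrho2)
        have u2 : a * (1 - rho ^ 2) ≤ 1 :=
          mul_le_one₀ ha.2 (sub_nonneg.2 hrho2) (by linarith [sq_nonneg rho])
        rw [abs_le]
        constructor <;> linarith
      have h2 := mul_le_mul_of_nonneg_left h1 (abs_nonneg nu)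
      have h3 := mul_le_mul_of_nonneg_right habs (abs_nonneg lam)
      linarith
    have e2 : |b * Y| ≤ n ^ 2 := by
      rw [abs_mul, sq]; gcongr
    gcongr
  linarith

/-- The weight `|ν|` in the first bound gives linear growth in `b`; without it the bound fails for
`ν = 0`, where the equation is linear with forcing of order `b²`. This is why that case is treated
separately. -/
lemma riccati_growth (hH : 0 < H) (hC0 : 0 ≤ C0) (hrho : rho ∈ Icc (-1 : ℝ) 1) :
    ∃ B : ℝ, 0 < B ∧
      ∀ K : ℝ → ℝ, LogConvexKernel K → (∀ t ∈ Ioc 0 T, K t ≤ C0 * t ^ (H - 1 / 2)) →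
      ∀ a ∈ Icc (0 : ℝ) 1, ∀ (b : ℝ) (psi : ℝ → ℂ),
      IsRiccatiSolution K lam nu rho T ((a : ℂ) + Complex.I * b) psi →
      ∀ t ∈ Icc 0 T, |nu| * ‖psi t‖ ≤ B * (1 + |b|) ∧
        ‖riccatiF lam nu rho ((a : ℂ) + Complex.I * b) (psi t)‖ ≤ B * (1 + b ^ 2) := by
  by_cases hnu : nu = 0
  · subst hnu
    have hFeq : ∀ z x : ℂ, riccatiF lam 0 rho z x = 1 / 2 * (z ^ 2 - z) - lam * x := by
      intro z x; simp [riccatiF]; ring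
    obtain ⟨B, hB0, hB⟩ := LogConvexKernel.norm_le_of_comparison (T := T) (C := 2 + |lam|) hH hC0
      (by positivity)
    refine ⟨2 + |lam| * B, by positivity, fun K hK hb a ha b psi hpsi t ht => ⟨by simp; positivity, ?_⟩⟩
    have hF := (continuous_riccatiF lam 0 rho ((a : ℂ) + Complex.I * b)).comp_continuousOn hpsi.1
    have h1 := norm_forcing_le ha b
    have h2 := hB K hK hb psi _ 0 (1 + b ^ 2) (by positivity) (by simp; positivity) hpsi.1 hF
      (fun t ht => by rw [hpsi.2 t ht, zero_add]; rfl)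
      (by
        intro s hs hR
        refine (Complex.re_le_norm _).trans ?_
        rw [norm_mul, RCLike.norm_conj]
        simp only [Function.comp]
        rw [hFeq]
        have h3 := norm_sub_le (1 / 2 * (((a : ℂ) + Complex.I * b) ^ 2 - ((a : ℂ) + Complex.I * b)))
          (lam * psi s)
        rw [norm_mul (lam : ℂ), Complex.norm_real, Real.norm_eq_abs] at h3
        calc ‖psi s‖ * _ ≤ ‖psi s‖ * ((2 + |lam|) * ‖psi s‖) := by
              gcongr
              linarith
          _ = _ := by ring) t ht
    rw [hFeq]
    have h3 := norm_sub_le (1 / 2 * (((a : ℂ) + Complex.I * b) ^ 2 - ((a : ℂ) + Complex.I * b)))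
      (lam * psi t)
    rw [norm_mul (lam : ℂ), Complex.norm_real, Real.norm_eq_abs] at h3
    have h4 := mul_le_mul_of_nonneg_left h2 (abs_nonneg lam)
    linarith
  · obtain ⟨B, hB0, hB⟩ := LogConvexKernel.norm_le_of_comparison (T := T)
      (C := 3 * |nu| + 2 * |lam|) hH hC0 (by positivity)
    have hnu' : 0 < |nu| := abs_pos.2 hnu
    set q := (|nu| + |lam|) / |nu| with hq
    have hq0 : 0 ≤ q := by positivity
    refine ⟨(B + 1) + 2 + 2 * q * (B + 1) + (B + 1) ^ 2, by positivity,
      fun K hK hb a ha b psi hpsi t ht => ?_⟩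
    have hre := hpsi.re_nonpos hH hC0 hrho hK hb ha
    have hF := (continuous_riccatiF lam nu rho ((a : ℂ) + Complex.I * b)).comp_continuousOn hpsi.1
    have habs : |rho| ≤ 1 := abs_le.2 hrho
    have hb0 := abs_nonneg b
    have hw : ‖Complex.I * (rho * b : ℝ)‖ ≤ |b| := by
      rw [norm_mul, Complex.norm_I, one_mul, Complex.norm_real, Real.norm_eq_abs, abs_mul]
      nlinarith
    have h2 := hB K hK hb (fun s => (nu : ℂ) * psi s + Complex.I * (rho * b : ℝ))
      (fun s => (nu : ℂ) * riccatiF lam nu rho ((a : ℂ) + Complex.I * b) (psi s))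
      (Complex.I * (rho * b : ℝ)) (1 + |b|) (by positivity) (by linarith)
      ((continuousOn_const.mul hpsi.1).add continuousOn_const) (continuousOn_const.mul hF)
      (by
        intro t ht
        rw [hpsi.2 t ht, add_comm, ← intervalIntegral.integral_const_mul]
        congr 1
        apply intervalIntegral.integral_congr
        intro s _
        simp only
        ring)
      (fun s hs hR => rotated_forcing_le hrho ha (hre s hs) hR) t ht
    have h3 : |nu| * ‖psi t‖ ≤ (B + 1) * (1 + |b|) := by
      have e : (nu : ℂ) * psi t = ((nu : ℂ) * psi t + Complex.I * (rho * b : ℝ))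
        - Complex.I * (rho * b : ℝ) := by ring
      have := norm_sub_le ((nu : ℂ) * psi t + Complex.I * (rho * b : ℝ)) (Complex.I * (rho * b : ℝ))
      rw [← e, norm_mul, Complex.norm_real, Real.norm_eq_abs] at this
      linarith
    have hbb : (1 + |b|) ^ 2 ≤ 2 * (1 + b ^ 2) := by
      nlinarith [sq_nonneg (|b| - 1), sq_abs b]
    constructor
    · refine h3.trans ?_
      apply mul_le_mul_of_nonneg_right _ (by positivity)
      have : 0 ≤ 2 + 2 * q * (B + 1) + (B + 1) ^ 2 := by positivity
      linarith
    · have hz := norm_strip_le ha b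
      have h1 := norm_forcing_le ha b
      set z := (a : ℂ) + Complex.I * b with hzd
      have e1 : ‖((rho : ℂ) * nu * z - lam) * psi t‖ ≤ 2 * q * (B + 1) * (1 + b ^ 2) := by
        rw [norm_mul]
        have e2 : ‖(rho : ℂ) * nu * z - lam‖ ≤ (|nu| + |lam|) * (1 + |b|) := by
          refine (norm_sub_le _ _).trans ?_
          rw [norm_mul, norm_mul]
          simp only [Complex.norm_real, Real.norm_eq_abs]
          have : |rho| * |nu| * ‖z‖ ≤ 1 * |nu| * (1 + |b|) := by gcongr
          nlinarith [abs_nonneg lam]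
        have e3 : ‖psi t‖ ≤ (B + 1) * (1 + |b|) / |nu| := by
          rw [le_div_iff₀ hnu']; linarith
        calc _ ≤ ((|nu| + |lam|) * (1 + |b|)) * ((B + 1) * (1 + |b|) / |nu|) := by gcongr
          _ = q * (B + 1) * (1 + |b|) ^ 2 := by rw [hq]; ring
          _ ≤ q * (B + 1) * (2 * (1 + b ^ 2)) := by gcongr
          _ = _ := by ring
      have e4 : ‖(nu : ℂ) ^ 2 / 2 * psi t ^ 2‖ ≤ (B + 1) ^ 2 * (1 + b ^ 2) := by
        have : (nu : ℂ) ^ 2 / 2 * psi t ^ 2 = ((nu : ℂ) * psi t) ^ 2 / 2 := by ring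
        rw [this, norm_div, norm_pow, norm_mul]
        simp only [Complex.norm_real, Real.norm_eq_abs, Complex.norm_ofNat]
        calc (|nu| * ‖psi t‖) ^ 2 / 2 ≤ ((B + 1) * (1 + |b|)) ^ 2 / 2 := by gcongr
          _ = (B + 1) ^ 2 * ((1 + |b|) ^ 2 / 2) := by ring
          _ ≤ _ := by gcongr; linarith
      unfold riccatiF
      refine (norm_add₃_le).trans ?_
      have : 0 ≤ (B + 1) * (1 + b ^ 2) := by positivity
      nlinarith

lemma continuousOn_conv {Khat : ℝ → ℝ} (hKc : Continuous Khat) {g : ℝ → ℂ} (hT : 0 ≤ T)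
    (hg : ContinuousOn g (Icc 0 T)) :
    ContinuousOn (fun t => ∫ s in (0 : ℝ)..t, (Khat (t - s) : ℂ) * g s) (Icc 0 T) := by
  set g' : ℝ → ℂ := IccExtend hT ((Icc 0 T).domRestrict g) with hgdef
  have hg' : Continuous g' := continuous_IccExtend_iff.2 hg.domRestrict
  have hc : Continuous fun t => ∫ s in (0 : ℝ)..t, (Khat (t - s) : ℂ) * g' s := by
    apply intervalIntegral.continuous_parametric_intervalIntegral_of_continuous
      (f := fun t s => (Khat (t - s) : ℂ) * g' s) _ continuous_id
    simp only [Function.uncurry_def]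
    fun_prop
  refine hc.continuousOn.congr ?_
  intro t ht
  apply intervalIntegral.integral_congr
  intro s hs
  rw [uIcc_of_le ht.1] at hs
  simp only
  rw [hgdef, IccExtend_of_mem _ _ ⟨hs.1, hs.2.trans ht.2⟩]
  rfl

/-- Stability of the Riccati equation under `L¹` perturbations of the kernel. -/
lemma riccati_stability (hH : 0 < H) (hT : 0 ≤ T) (hC0 : 0 ≤ C0) (hrho : rho ∈ Icc (-1 : ℝ) 1) :
    ∃ B : ℝ, 0 < B ∧
      ∀ K Khat : ℝ → ℝ, LogConvexKernel K → (∀ t ∈ Ioc 0 T, K t ≤ C0 * t ^ (H - 1 / 2)) →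
      LogConvexKernel Khat → Continuous Khat → (∀ t ∈ Ioc 0 T, Khat t ≤ C0 * t ^ (H - 1 / 2)) →
      ∀ ε, 0 < ε → (∀ t ∈ Icc 0 T, ∫ u in (0 : ℝ)..t, |Khat u - K u| ≤ ε) →
      ∀ a ∈ Icc (0 : ℝ) 1, ∀ (b : ℝ) (psi psiHat : ℝ → ℂ),
      IsRiccatiSolution K lam nu rho T ((a : ℂ) + Complex.I * b) psi →
      IsRiccatiSolution Khat lam nu rho T ((a : ℂ) + Complex.I * b) psiHat →
      ∀ t ∈ Icc 0 T, ‖psiHat t - psi t‖ ≤ B * (1 + b ^ 4) * ε := by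
  obtain ⟨B, hB0, hB⟩ := riccati_growth (T := T) (C0 := C0) (lam := lam) (nu := nu) hH hC0 hrho
  obtain ⟨B3, hB30, hB3⟩ := LogConvexKernel.norm_le_of_comparison (T := T)
    (C := |nu| + |lam| + 1) hH hC0 (by positivity)
  set B' := |nu| + |lam| + |nu| * B + 1 with hB'
  have hB'0 : 0 < B' := by positivity
  refine ⟨4 * (B3 * B' + 1) * B, by positivity, fun K Khat hK hb hKh hKc hbh ε hε hdist a ha b psi psiHat
    hpsi hpsiHat t ht => ?_⟩
  have hre := hpsi.re_nonpos hH hC0 hrho hK hb ha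
  have hreh := hpsiHat.re_nonpos hH hC0 hrho hKh hbh ha
  have hgr := hB K hK hb a ha b psi hpsi
  have hgrh := hB Khat hKh hbh a ha b psiHat hpsiHat
  have hz := norm_strip_le ha b
  set z := (a : ℂ) + Complex.I * b with hzd
  have hF := (continuous_riccatiF lam nu rho z).comp_continuousOn hpsi.1
  have hFh := (continuous_riccatiF lam nu rho z).comp_continuousOn hpsiHat.1
  set F := fun s => riccatiF lam nu rho z (psi s) with hFd
  set Fh := fun s => riccatiF lam nu rho z (psiHat s) with hFhd
  replace hF : ContinuousOn F (Icc 0 T) := hF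
  replace hFh : ContinuousOn Fh (Icc 0 T) := hFh
  -- Splitting `ψ̂ - ψ = h1 + (K̂ - K) * F` isolates the kernel error as a small term. Only `h1` has
  -- the form required by the comparison principle, namely a convolution with the single kernel
  -- `Khat`.
  set h1 : ℝ → ℂ := fun t => ∫ s in (0 : ℝ)..t, (Khat (t - s) : ℂ) * (Fh s - F s) with hh1
  have hh1c : ContinuousOn h1 (Icc 0 T) := continuousOn_conv hKc hT (hFh.sub hF)
  have habs : |rho| ≤ 1 := abs_le.2 hrho
  have hdiff : ∀ t ∈ Icc 0 T, ‖psiHat t - psi t - h1 t‖ ≤ B * (1 + b ^ 2) * ε := by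
    intro t ht
    have i1 := hKh.integrable_conv_complex hF ht
    have i2 := hKh.integrable_conv_complex hFh ht
    have i3 := hK.integrable_conv_complex hF ht
    have e : psiHat t - psi t - h1 t =
        ∫ s in (0 : ℝ)..t, ((Khat (t - s) : ℂ) - K (t - s)) * F s := by
      simp only [hh1]
      rw [hpsiHat.2 t ht, hpsi.2 t ht]
      have e1 : (fun s => (Khat (t - s) : ℂ) * (Fh s - F s)) =
        fun s => (Khat (t - s) : ℂ) * Fh s - (Khat (t - s) : ℂ) * F s := by
        ext s; ring
      have e2 : (fun s => ((Khat (t - s) : ℂ) - K (t - s)) * F s) =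
        fun s => (Khat (t - s) : ℂ) * F s - (K (t - s) : ℂ) * F s := by
        ext s; ring
      rw [e1, e2, intervalIntegral.integral_sub i2 i1, intervalIntegral.integral_sub i1 i3]
      simp only [hFd, hFhd]
      ring
    rw [e]
    have i4 : IntervalIntegrable (fun u => |Khat u - K u|) volume 0 t :=
      ((hKh.integrable t).sub (hK.integrable t)).abs
    have i5 := i4.comp_sub_left t
    simp only [sub_zero, sub_self] at i5
    have h2 : ‖∫ s in (0 : ℝ)..t, ((Khat (t - s) : ℂ) - K (t - s)) * F s‖ ≤
        ∫ s in (0 : ℝ)..t, |Khat (t - s) - K (t - s)| * (B * (1 + b ^ 2)) := by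
      apply intervalIntegral.norm_integral_le_of_norm_le ht.1
      · refine Eventually.of_forall fun s hs => ?_
        rw [norm_mul, ← Complex.ofReal_sub, Complex.norm_real, Real.norm_eq_abs]
        gcongr
        exact (hgr s ⟨hs.1.le, hs.2.trans ht.2⟩).2
      · exact i5.symm.mul_const _
    refine h2.trans ?_
    rw [intervalIntegral.integral_mul_const,
      intervalIntegral.integral_comp_sub_left (fun u => |Khat u - K u|) t, sub_zero, sub_self,
      mul_comm]
    gcongr
    exact hdist t ht
  -- `R` bounds `‖c‖ ‖f0‖`, the inhomogeneity in the linear equation for `h1`. When `‖h1‖ ≥ R` it is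
  -- absorbed into `‖h1‖²`, which accounts for the `+ 1` in the comparison constant.
  set R := B' * (1 + |b|) * (B * (1 + b ^ 2) * ε) with hR
  have hR0 : 0 < R := by positivity
  have hcomp := hB3 Khat hKh hbh h1 (fun s => Fh s - F s) 0 R hR0 (by simp; exact hR0.le) hh1c
    (hFh.sub hF) (fun t _ => by rw [zero_add]) (by
      intro s hs hRs
      set c := (rho : ℂ) * nu * z - lam + (nu : ℂ) ^ 2 / 2 * (psiHat s + psi s) with hc
      set f0 := psiHat s - psi s - h1 s with hf0
      have e1 : Fh s - F s = c * h1 s + c * f0 := by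
        simp only [hFd, hFhd]
        rw [riccatiF_sub, ← hc, hf0]; ring
      have hn2 : (starRingEnd ℂ) (h1 s) * (c * h1 s) = ((‖h1 s‖ ^ 2 : ℝ) : ℂ) * c := by
        rw [Complex.ofReal_pow, ← Complex.conj_mul']; ring
      rw [e1, mul_add, Complex.add_re, hn2, Complex.re_ofReal_mul]
      -- Only the modulus of `c` grows with `b`: in the real part `z` enters through `a`, and the
      -- quadratic term helps because both solutions have nonpositive real part.
      have hcre : c.re ≤ |nu| + |lam| := by
        have : c.re = rho * nu * a - lam + nu ^ 2 / 2 * ((psiHat s).re + (psi s).re) := by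
          have h3 : ((nu : ℂ) ^ 2 / 2) = ((nu ^ 2 / 2 : ℝ) : ℂ) := by push_cast; ring
          rw [hc, h3, hzd, Complex.add_re, Complex.re_ofReal_mul]
          simp [Complex.mul_re, Complex.mul_im]
        rw [this]
        have t1 : nu ^ 2 / 2 * ((psiHat s).re + (psi s).re) ≤ 0 :=
          mul_nonpos_of_nonneg_of_nonpos (by positivity) (by linarith [hre s hs, hreh s hs])
        have t2 : |rho * nu * a| ≤ |nu| := by
          rw [abs_mul, abs_mul, abs_of_nonneg ha.1]
          calc |rho| * |nu| * a ≤ 1 * |nu| * 1 := by gcongr <;> first | exact ha.1 | exact ha.2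
            _ = |nu| := by ring
        linarith [le_abs_self (rho * nu * a), neg_abs_le lam]
      have hcn : ‖c‖ ≤ B' * (1 + |b|) := by
        have t1 : ‖(rho : ℂ) * nu * z - lam‖ ≤ (|nu| + |lam|) * (1 + |b|) := by
          refine (norm_sub_le _ _).trans ?_
          rw [norm_mul, norm_mul]
          simp only [Complex.norm_real, Real.norm_eq_abs]
          have : |rho| * |nu| * ‖z‖ ≤ 1 * |nu| * (1 + |b|) := by gcongr
          nlinarith [abs_nonneg lam, abs_nonneg b]
        have t2 : ‖(nu : ℂ) ^ 2 / 2 * (psiHat s + psi s)‖ ≤ |nu| * (B * (1 + |b|)) := by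
          rw [norm_mul, norm_div, norm_pow]
          simp only [Complex.norm_real, Real.norm_eq_abs, Complex.norm_ofNat]
          have := norm_add_le (psiHat s) (psi s)
          have g1 := (hgr s hs).1
          have g2 := (hgrh s hs).1
          calc |nu| ^ 2 / 2 * ‖psiHat s + psi s‖ ≤ |nu| ^ 2 / 2 * (‖psiHat s‖ + ‖psi s‖) := by gcongr
            _ = |nu| * ((|nu| * ‖psiHat s‖ + |nu| * ‖psi s‖) / 2) := by ring
            _ ≤ _ := by gcongr; linarith
        refine (norm_add_le _ _).trans ?_
        rw [hB']
        have := abs_nonneg b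
        nlinarith
      have hlast : ((starRingEnd ℂ) (h1 s) * (c * f0)).re ≤ ‖h1 s‖ * R := by
        refine (Complex.re_le_norm _).trans ?_
        rw [norm_mul, RCLike.norm_conj, norm_mul]
        gcongr
        exact mul_le_mul hcn (hdiff s hs) (norm_nonneg _) (by positivity)
      have h5 : ‖h1 s‖ * R ≤ ‖h1 s‖ * ‖h1 s‖ := by gcongr
      have h6 := mul_le_mul_of_nonneg_left hcre (sq_nonneg ‖h1 s‖)
      nlinarith) t ht
  have hfin := norm_add_le (psiHat t - psi t - h1 t) (h1 t)
  rw [sub_add_cancel] at hfin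
  have hd := hdiff t ht
  have hb4 : (1 + |b|) * (1 + b ^ 2) ≤ 4 * (1 + b ^ 4) := by
    have e1 : b ^ 2 = |b| ^ 2 := (sq_abs b).symm
    have e2 : b ^ 4 = |b| ^ 4 := by rw [← abs_pow, abs_of_nonneg (by positivity)]
    rw [e1, e2]
    have := abs_nonneg b
    nlinarith [sq_nonneg (|b| - 1), sq_nonneg (|b| ^ 2 - |b|), sq_nonneg (|b| ^ 2 - 1)]
  have hb5 : 1 + b ^ 2 ≤ (1 + |b|) * (1 + b ^ 2) :=
    le_mul_of_one_le_left (by positivity) (by linarith [abs_nonneg b])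
  calc ‖psiHat t - psi t‖ ≤ B * (1 + b ^ 2) * ε + B3 * R := by linarith
    _ ≤ B * ((1 + |b|) * (1 + b ^ 2)) * ε + B3 * R := by gcongr
    _ = (B3 * B' + 1) * B * ε * ((1 + |b|) * (1 + b ^ 2)) := by rw [hR]; ring
    _ ≤ (B3 * B' + 1) * B * ε * (4 * (1 + b ^ 4)) := by gcongr
    _ = _ := by ring

end

end RoughHeston

namespace RoughHeston

/-! Kernels -/

lemma fracKernel_mul {H : ℝ} {c t : ℝ} (hc : 0 ≤ c) (ht : 0 ≤ t) :
    fracKernel H (c * t) = c ^ (H - 1 / 2) * fracKernel H t := by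
  unfold fracKernel; rw [Real.mul_rpow hc ht, mul_div_assoc]

lemma logConvexKernel_fracKernel {H : ℝ} (hH : 0 < H) (hH' : H < 1 / 2) :
    LogConvexKernel (fracKernel H) := by
  have hΓ : 0 < Real.Gamma (H + 1 / 2) := Real.Gamma_pos_of_pos (by linarith)
  have hd : ∀ t : ℝ, 0 < t → HasDerivAt (fracKernel H)
      ((H - 1 / 2) * t ^ (H - 1 / 2 - 1) / Real.Gamma (H + 1 / 2)) t := fun t ht =>
    (Real.hasDerivAt_rpow_const (Or.inl ht.ne')).div_const _
  have hp : ∀ t : ℝ, 0 < t → 0 < t ^ (H - 1 / 2 - 1) / Real.Gamma (H + 1 / 2) := fun t ht =>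
    div_pos (Real.rpow_pos_of_pos ht _) hΓ
  refine ⟨fun t ht => div_pos (Real.rpow_pos_of_pos ht _) hΓ, fun t ht => (hd t ht).differentiableAt,
    ?_, ?_, ?_, ?_⟩
  · have : ContinuousOn (fun t : ℝ => (H - 1 / 2) * t ^ (H - 1 / 2 - 1) / Real.Gamma (H + 1 / 2))
        (Ioi 0) := by
      apply ContinuousOn.div_const
      apply continuousOn_const.mul
      exact ContinuousOn.rpow_const continuousOn_id (fun t ht => Or.inl (ne_of_gt ht))
    exact this.congr fun t ht => (hd t ht).deriv
  · intro t ht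
    rw [(hd t ht).deriv, mul_div_assoc]
    exact mul_nonpos_of_nonpos_of_nonneg (by linarith) (hp t ht).le
  · intro a b ha hab
    have hb : 0 < b := ha.trans_le hab
    rw [(hd a ha).deriv, (hd b hb).deriv]
    unfold fracKernel
    have e1 : a ^ (H - 1 / 2) = a ^ (H - 1 / 2 - 1) * a := by
      rw [← Real.rpow_add_one ha.ne']; congr 1; ring
    have e2 : b ^ (H - 1 / 2) = b ^ (H - 1 / 2 - 1) * b := by
      rw [← Real.rpow_add_one hb.ne']; congr 1; ring
    rw [e1, e2]
    set A := a ^ (H - 1 / 2 - 1) / Real.Gamma (H + 1 / 2) with hA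
    set B := b ^ (H - 1 / 2 - 1) / Real.Gamma (H + 1 / 2) with hB
    have hAB : 0 < A * B := mul_pos (hp a ha) (hp b hb)
    have l1 : (H - 1 / 2) * a ^ (H - 1 / 2 - 1) / Real.Gamma (H + 1 / 2) *
        (b ^ (H - 1 / 2 - 1) * b / Real.Gamma (H + 1 / 2)) = (H - 1 / 2) * (A * B) * b := by
      rw [hA, hB]; ring
    have l2 : (H - 1 / 2) * b ^ (H - 1 / 2 - 1) / Real.Gamma (H + 1 / 2) *
        (a ^ (H - 1 / 2 - 1) * a / Real.Gamma (H + 1 / 2)) = (H - 1 / 2) * (A * B) * a := by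
      rw [hA, hB]; ring
    rw [l1, l2]
    apply mul_le_mul_of_nonpos_left hab
    exact mul_nonpos_of_nonpos_of_nonneg (by linarith) hAB.le
  · intro t
    exact (intervalIntegral.intervalIntegrable_rpow' (by linarith)).div_const _

/-- For the ratio inequality the double sum is symmetrized in `i` and `j`. Each pair then
contributes `v i v j` times a product of two factors of equal sign, since `exp` is monotone and `a ≤
b`. -/
lemma logConvexKernel_sum_exp {ι : Type*} [Fintype ι] (v x : ι → ℝ) (hv : ∀ i, 0 ≤ v i)
    (hx : ∀ i, 0 ≤ x i) (hpos : ∃ i, 0 < v i) :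
    LogConvexKernel fun t => ∑ i, v i * Real.exp (-(x i * t)) := by
  have hd : ∀ t : ℝ, HasDerivAt (fun t => ∑ i, v i * Real.exp (-(x i * t)))
      (∑ i, v i * (Real.exp (-(x i * t)) * (-(x i)))) t := by
    intro t
    apply HasDerivAt.fun_sum
    intro i _
    have : HasDerivAt (fun t => -(x i * t)) (-(x i)) t := by
      simpa using ((hasDerivAt_id t).const_mul (x i)).fun_neg
    exact this.exp.const_mul (v i)
  have hder : deriv (fun t => ∑ i, v i * Real.exp (-(x i * t))) =
      fun t => ∑ i, v i * (Real.exp (-(x i * t)) * (-(x i))) := funext fun t => (hd t).deriv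
  refine ⟨fun t _ => ?_, fun t _ => (hd t).differentiableAt, ?_, ?_, ?_, ?_⟩
  · obtain ⟨i, hi⟩ := hpos
    exact Finset.sum_pos' (fun i _ => mul_nonneg (hv i) (Real.exp_pos _).le)
      ⟨i, Finset.mem_univ i, mul_pos hi (Real.exp_pos _)⟩
  · rw [hder]
    fun_prop
  · intro t _
    rw [hder]
    apply Finset.sum_nonpos
    intro i _
    have := mul_nonneg (hv i) (mul_nonneg (Real.exp_pos (-(x i * t))).le (hx i))
    linarith
  · intro a b _ hab
    rw [hder]
    simp only
    rw [Finset.sum_mul_sum, Finset.sum_mul_sum, ← sub_nonneg, ← Finset.sum_sub_distrib]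
    simp_rw [← Finset.sum_sub_distrib]
    set f : ι → ι → ℝ := fun i j =>
      v i * (Real.exp (-(x i * b)) * -x i) * (v j * Real.exp (-(x j * a))) -
        v i * (Real.exp (-(x i * a)) * -x i) * (v j * Real.exp (-(x j * b))) with hf
    change 0 ≤ ∑ i, ∑ j, f i j
    have hsym : ∑ i, ∑ j, f i j = ∑ i, ∑ j, f j i := Finset.sum_comm
    have h2 : 0 ≤ ∑ i, ∑ j, (f i j + f j i) := by
      apply Finset.sum_nonneg; intro i _
      apply Finset.sum_nonneg; intro j _
      have e : f i j + f j i = v i * v j * ((x i - x j) *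
          (Real.exp (-(x i * a) + -(x j * b)) - Real.exp (-(x i * b) + -(x j * a)))) := by
        simp only [hf, Real.exp_add]; ring
      rw [e]
      apply mul_nonneg (mul_nonneg (hv i) (hv j))
      rcases le_total (x i) (x j) with h | h
      · apply mul_nonneg_of_nonpos_of_nonpos (by linarith)
        rw [sub_nonpos]
        apply Real.exp_le_exp.2
        nlinarith
      · apply mul_nonneg (by linarith)
        rw [sub_nonneg]
        apply Real.exp_le_exp.2
        nlinarith
    simp_rw [Finset.sum_add_distrib] at h2
    linarith
  · intro t
    apply Continuous.intervalIntegrable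
    fun_prop

/-! Gaussian quadrature -/

namespace IsGaussQuadrature

variable {w : ℝ → ℝ} {l u : ℝ} {m : ℕ} {x v : Fin m → ℝ}

/-- The test polynomial `∏ (X - x_k)²` over `k ≠ j` has degree `2m - 2`, within the exactness range,
and annihilates every other node; its integral is positive. -/
lemma weight_pos (hq : IsGaussQuadrature w l u m x v) (hlu : l < u)
    (hw : ContinuousOn w (Icc l u)) (hpos : ∀ y ∈ Icc l u, 0 < w y) (j : Fin m) : 0 < v j := by
  classical
  set p : Polynomial ℝ := ∏ k ∈ Finset.univ.erase j, (Polynomial.X - Polynomial.C (x k)) ^ 2 with hp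
  have hm : 0 < m := j.pos
  have hdeg : p.natDegree < 2 * m := by
    have h1 : p.natDegree ≤ ∑ k ∈ Finset.univ.erase j, 2 := by
      refine (Polynomial.natDegree_prod_le _ _).trans (Finset.sum_le_sum fun k _ => ?_)
      rw [Polynomial.natDegree_pow, Polynomial.natDegree_X_sub_C]
    rw [Finset.sum_const, Finset.card_erase_of_mem (Finset.mem_univ j), Finset.card_univ,
      Fintype.card_fin, smul_eq_mul] at h1
    omega
  have heval : ∀ y, p.eval y = ∏ k ∈ Finset.univ.erase j, (y - x k) ^ 2 := by
    intro y; simp [hp, Polynomial.eval_prod]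
  have hnn : ∀ y, 0 ≤ p.eval y := fun y => by
    rw [heval]; exact Finset.prod_nonneg fun k _ => sq_nonneg _
  have hint : 0 < ∫ y in l..u, p.eval y * w y := by
    have hc : ContinuousOn (fun y => p.eval y * w y) (Icc l u) :=
      p.continuous.continuousOn.mul hw
    have hp0 : p ≠ 0 := by
      rw [hp, Finset.prod_ne_zero_iff]
      intro k _
      exact pow_ne_zero 2 (Polynomial.X_sub_C_ne_zero _)
    obtain ⟨y, hy, hyr⟩ : ∃ y ∈ Ioo l u, p.eval y ≠ 0 := by
      by_contra hcon
      push Not at hcon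
      exact hp0 (Polynomial.eq_zero_of_infinite_isRoot p
        ((Ioo_infinite hlu).mono fun y hy => hcon y hy))
    apply intervalIntegral.integral_pos hlu hc
    · intro z hz; exact mul_nonneg (hnn z) (hpos z ⟨hz.1.le, hz.2⟩).le
    · exact ⟨y, ⟨hy.1.le, hy.2.le⟩,
        mul_pos (lt_of_le_of_ne (hnn y) hyr.symm) (hpos y ⟨hy.1.le, hy.2.le⟩)⟩
  rw [← hq.2 p hdeg, Finset.sum_eq_single j] at hint
  · exact pos_of_mul_pos_left hint (hnn _)
  · intro k _ hkj
    rw [heval, Finset.prod_eq_zero (Finset.mem_erase.2 ⟨hkj, Finset.mem_univ k⟩) (by simp), mul_zero]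
  · simp

lemma sum_weights (hq : IsGaussQuadrature w l u m x v) (hm : 1 ≤ m) :
    ∑ j, v j = ∫ y in l..u, w y := by
  have := hq.2 1 (by simp; omega)
  simpa using this

/-- The error of a Gaussian rule is controlled by uniform polynomial approximation. -/
lemma error_le (hq : IsGaussQuadrature w l u m x v) (hm : 1 ≤ m) (hlu : l < u)
    (hw : ContinuousOn w (Icc l u)) (hpos : ∀ y ∈ Icc l u, 0 < w y) {f : ℝ → ℝ}
    (hf : ContinuousOn f (Icc l u)) {p : Polynomial ℝ} (hp : p.natDegree < 2 * m) {η : ℝ}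
    (hfp : ∀ y ∈ Icc l u, |f y - p.eval y| ≤ η) :
    |∑ j, v j * f (x j) - ∫ y in l..u, w y * f y| ≤ 2 * η * ∫ y in l..u, w y := by
  have hu : uIcc l u = Icc l u := uIcc_of_le hlu.le
  have i1 : IntervalIntegrable (fun y => w y * f y) volume l u := by
    apply ContinuousOn.intervalIntegrable; rw [hu]; exact hw.mul hf
  have i2 : IntervalIntegrable (fun y => p.eval y * w y) volume l u := by
    apply ContinuousOn.intervalIntegrable; rw [hu]; exact p.continuous.continuousOn.mul hw
  have i3 : IntervalIntegrable w volume l u := by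
    apply ContinuousOn.intervalIntegrable; rwa [hu]
  have e : ∑ j, v j * f (x j) - ∫ y in l..u, w y * f y =
      ∑ j, v j * (f (x j) - p.eval (x j)) - ∫ y in l..u, (w y * f y - p.eval y * w y) := by
    rw [intervalIntegral.integral_sub i1 i2, ← hq.2 p hp]
    simp_rw [mul_sub, Finset.sum_sub_distrib]
    ring
  have b1 : |∑ j, v j * (f (x j) - p.eval (x j))| ≤ η * ∫ y in l..u, w y := by
    rw [← hq.sum_weights hm, mul_comm, Finset.sum_mul]
    refine (Finset.abs_sum_le_sum_abs _ _).trans (Finset.sum_le_sum fun j _ => ?_)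
    have := hq.weight_pos hlu hw hpos j
    rw [abs_mul, abs_of_pos this]
    gcongr
    exact hfp _ (hq.1 j)
  have b2 : |∫ y in l..u, (w y * f y - p.eval y * w y)| ≤ η * ∫ y in l..u, w y := by
    rw [← intervalIntegral.integral_const_mul, ← Real.norm_eq_abs]
    apply intervalIntegral.norm_integral_le_of_norm_le hlu.le
    · refine Eventually.of_forall fun y hy => ?_
      have hy' : y ∈ Icc l u := ⟨hy.1.le, hy.2⟩
      have e2 : w y * f y - p.eval y * w y = (f y - p.eval y) * w y := by ring
      have := hpos y hy'
      rw [e2, Real.norm_eq_abs, abs_mul, abs_of_pos this]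
      gcongr
      exact hfp y hy'
    · exact i3.const_mul η
  rw [e]
  refine (abs_sub _ _).trans ?_
  linarith

end IsGaussQuadrature

/-- Term by term, `|y|^(k+n) ≤ ε^n (|y|/ε)^(k+n)` because `ε ≤ 1`. The geometric gain `ε^n` is
bought with a larger exponential, which the decay of `e^(-xt)` will absorb. -/
lemma abs_exp_sub_sum_le {ε : ℝ} (hε : 0 < ε) (hε1 : ε ≤ 1) (y : ℝ) (n : ℕ) :
    |Real.exp y - ∑ k ∈ Finset.range n, y ^ k / k.factorial| ≤ ε ^ n * Real.exp (|y| / ε) := by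
  have h1 := Complex.norm_exp_sub_sum_le_exp_norm_sub_sum (y : ℂ) n
  rw [Complex.norm_real, Real.norm_eq_abs] at h1
  have e1 : Complex.exp (y : ℂ) - ∑ k ∈ Finset.range n, (y : ℂ) ^ k / (k.factorial : ℂ) =
      ((Real.exp y - ∑ k ∈ Finset.range n, y ^ k / k.factorial : ℝ) : ℂ) := by
    push_cast; rfl
  rw [e1, Complex.norm_real, Real.norm_eq_abs] at h1
  refine h1.trans ?_
  set a := |y| with ha
  have ha0 : 0 ≤ a := abs_nonneg y
  have hs : ∀ b : ℝ, HasSum (fun k : ℕ => b ^ k / k.factorial) (Real.exp b) := fun b => by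
    rw [Real.exp_eq_exp_ℝ]; exact NormedSpace.expSeries_div_hasSum_exp b
  have t1 := (hasSum_nat_add_iff' n).2 (hs a)
  have t2 := ((hasSum_nat_add_iff' n).2 (hs (a / ε))).mul_left (ε ^ n)
  have t3 := hasSum_le (fun k => ?_) t1 t2
  · refine t3.trans ?_
    gcongr
    have : 0 ≤ ∑ i ∈ Finset.range n, (a / ε) ^ i / (i.factorial : ℝ) :=
      Finset.sum_nonneg fun i _ => by positivity
    linarith
  · rw [← mul_div_assoc]
    gcongr
    rw [div_pow, ← mul_div_assoc, le_div_iff₀ (by positivity), pow_add ε]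
    have : ε ^ k ≤ 1 := pow_le_one₀ hε.le hε1
    calc a ^ (k + n) * (ε ^ k * ε ^ n) ≤ a ^ (k + n) * (1 * ε ^ n) := by gcongr
      _ = _ := by ring

/-- Geometric convergence of Gaussian quadrature for `e^(-xt)` on an interval `[l, u]` with
`(u - l)/(u + l) ≤ δ < ε`. -/
lemma IsGaussQuadrature.exp_error_le {w : ℝ → ℝ} {l u : ℝ} {m : ℕ} {x v : Fin m → ℝ}
    (hq : IsGaussQuadrature w l u m x v) (hm : 1 ≤ m) (hl : 0 < l) (hlu : l < u)
    (hw : ContinuousOn w (Icc l u)) (hpos : ∀ y ∈ Icc l u, 0 < w y) {δ ε t : ℝ} (hε : 0 < ε)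
    (hε1 : ε ≤ 1) (hδε : δ ≤ ε) (hδ : u - l ≤ δ * (u + l)) (ht : 0 ≤ t) :
    |∑ j, v j * Real.exp (-(x j * t)) - ∫ y in l..u, w y * Real.exp (-(y * t))| ≤
      2 * ε ^ (2 * m) * ∫ y in l..u, w y * Real.exp (-(y * ((1 - δ / ε) / 2 * t))) := by
  set c := (u + l) / 2 with hc
  set κ := (1 - δ / ε) / 2 with hκ
  have hκ0 : 0 ≤ κ := by
    have : δ / ε ≤ 1 := by rw [div_le_one hε]; exact hδε
    rw [hκ]; linarith
  -- Taylor polynomial of `e^(-yt)` at the midpoint `c`. There `|c - y| ≤ δc`, so the remainder is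
  -- at most `ε^(2m) e^(-(1 - δ/ε)ct) = ε^(2m) e^(-2cκt)`. Since `2c ≥ u`, some decay in `y`
  -- survives, and summing over the grid again gives a Laplace integral of `w`.
  set p : Polynomial ℝ := ∑ k ∈ Finset.range (2 * m),
    Polynomial.C (Real.exp (-(c * t)) * t ^ k / k.factorial) *
      (Polynomial.C c - Polynomial.X) ^ k with hp
  have hdeg : p.natDegree < 2 * m := by
    have h1 : p.natDegree ≤ 2 * m - 1 := by
      apply Polynomial.natDegree_sum_le_of_forall_le
      intro k hk
      have hk' := Finset.mem_range.1 hk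
      refine (Polynomial.natDegree_C_mul_le _ _).trans (Polynomial.natDegree_pow_le.trans ?_)
      have h2 : (Polynomial.C c - Polynomial.X).natDegree ≤ 1 := by
        refine (Polynomial.natDegree_sub_le _ _).trans ?_
        simp
      calc k * _ ≤ k * 1 := Nat.mul_le_mul_left k h2
        _ ≤ _ := by omega
    omega
  have heval : ∀ y, p.eval y = Real.exp (-(c * t)) *
      ∑ k ∈ Finset.range (2 * m), ((c - y) * t) ^ k / k.factorial := by
    intro y
    rw [hp, Polynomial.eval_finsetSum, Finset.mul_sum]
    refine Finset.sum_congr rfl fun k _ => ?_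
    simp only [Polynomial.eval_mul, Polynomial.eval_C, Polynomial.eval_pow, Polynomial.eval_sub,
      Polynomial.eval_X]
    rw [mul_pow]
    ring
  have hfp : ∀ y ∈ Icc l u, |Real.exp (-(y * t)) - p.eval y| ≤
      ε ^ (2 * m) * Real.exp (-(u * (κ * t))) := by
    intro y hy
    have e1 : Real.exp (-(y * t)) = Real.exp (-(c * t)) * Real.exp ((c - y) * t) := by
      rw [← Real.exp_add]; congr 1; ring
    rw [heval, e1, ← mul_sub, abs_mul, abs_of_pos (Real.exp_pos _)]
    have h1 := abs_exp_sub_sum_le hε hε1 ((c - y) * t) (2 * m)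
    calc _ ≤ Real.exp (-(c * t)) * (ε ^ (2 * m) * Real.exp (|(c - y) * t| / ε)) := by gcongr
      _ = ε ^ (2 * m) * Real.exp (-(c * t) + |(c - y) * t| / ε) := by rw [Real.exp_add]; ring
      _ ≤ _ := by
        gcongr
        have h2 : |(c - y) * t| ≤ (δ * c) * t := by
          rw [abs_mul, abs_of_nonneg ht]
          gcongr
          rw [abs_le]
          constructor <;> rw [hc] <;> linarith [hy.1, hy.2]
        have h3 : |(c - y) * t| / ε ≤ (δ / ε) * (c * t) := by
          rw [div_le_iff₀ hε]
          calc _ ≤ (δ * c) * t := h2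
            _ = _ := by field_simp
        have h4 : u * (κ * t) ≤ (2 * c) * (κ * t) := by
          gcongr; rw [hc]; linarith
        have h5 : (2 * c) * (κ * t) = c * t - (δ / ε) * (c * t) := by rw [hκ]; ring
        linarith
  have h := hq.error_le hm hlu hw hpos (f := fun y => Real.exp (-(y * t))) (by fun_prop) hdeg hfp
  refine h.trans ?_
  have hu : uIcc l u = Icc l u := uIcc_of_le hlu.le
  rw [mul_assoc 2, mul_assoc 2, mul_assoc (ε ^ (2 * m)), ← intervalIntegral.integral_const_mul]
  gcongr
  apply intervalIntegral.integral_mono_on hlu.le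
  · apply ContinuousOn.intervalIntegrable; rw [hu]; exact continuousOn_const.mul hw
  · apply ContinuousOn.intervalIntegrable; rw [hu]; exact hw.mul (by fun_prop)
  · intro y hy
    have := hpos y hy
    rw [mul_comm]
    gcongr
    exact hy.2

/-- Crude bound for a quadrature rule on an interval of ratio at most `r`. -/
lemma IsGaussQuadrature.exp_sum_le {w : ℝ → ℝ} {l u : ℝ} {m : ℕ} {x v : Fin m → ℝ}
    (hq : IsGaussQuadrature w l u m x v) (hm : 1 ≤ m) (hlu : l < u)
    (hw : ContinuousOn w (Icc l u)) (hpos : ∀ y ∈ Icc l u, 0 < w y) {r t : ℝ} (hr : 0 < r)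
    (hlr : u ≤ r * l) (ht : 0 ≤ t) :
    ∑ j, v j * Real.exp (-(x j * t)) ≤ ∫ y in l..u, w y * Real.exp (-(y * (t / r))) := by
  have hu : uIcc l u = Icc l u := uIcc_of_le hlu.le
  calc ∑ j, v j * Real.exp (-(x j * t)) ≤ ∑ j, v j * Real.exp (-(l * t)) := by
        refine Finset.sum_le_sum fun j _ => ?_
        have := hq.weight_pos hlu hw hpos j
        have := (hq.1 j).1
        gcongr
    _ = ∫ y in l..u, w y * Real.exp (-(l * t)) := by
        rw [← Finset.sum_mul, hq.sum_weights hm, intervalIntegral.integral_mul_const]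
    _ ≤ _ := by
        apply intervalIntegral.integral_mono_on hlu.le
        · apply ContinuousOn.intervalIntegrable; rw [hu]; exact hw.mul continuousOn_const
        · apply ContinuousOn.intervalIntegrable; rw [hu]; exact hw.mul (by fun_prop)
        · intro y hy
          have := hpos y hy
          apply mul_le_mul_of_nonneg_left _ this.le
          apply Real.exp_le_exp.2
          rw [neg_le_neg_iff, ← mul_div_assoc, div_le_iff₀ hr]
          have := mul_le_mul_of_nonneg_right (hy.2.trans hlr) ht
          linarith

end RoughHeston

/-! ### Laplace representation and error decomposition of the approximating kernel. -/

namespace RoughHeston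

lemma cH_pos {H : ℝ} (hH : 0 < H) (hH' : H < 1 / 2) : 0 < cH H :=
  one_div_pos.2 (mul_pos (Real.Gamma_pos_of_pos (by linarith)) (Real.Gamma_pos_of_pos (by linarith)))

lemma weightFun_pos {H x : ℝ} (hH : 0 < H) (hH' : H < 1 / 2) (hx : 0 < x) : 0 < weightFun H x :=
  mul_pos (cH_pos hH hH') (Real.rpow_pos_of_pos hx _)

lemma continuousOn_weightFun (H : ℝ) {l u : ℝ} (hl : 0 < l) :
    ContinuousOn (weightFun H) (Icc l u) := by
  apply continuousOn_const.mul
  exact ContinuousOn.rpow_const continuousOn_id fun x hx => Or.inl (hl.trans_le hx.1).ne'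

lemma laplace_weightFun {H t : ℝ} (hH : 0 < H) (hH' : H < 1 / 2) (ht : 0 < t) :
    IntegrableOn (fun x => weightFun H x * Real.exp (-(x * t))) (Ioi 0) ∧
      ∫ x in Ioi 0, weightFun H x * Real.exp (-(x * t)) = fracKernel H t := by
  have hI := Real.integral_rpow_mul_exp_neg_mul_Ioi (a := 1 / 2 - H) (r := t) (by linarith) ht
  have e1 : 1 / 2 - H - 1 = -H - 1 / 2 := by ring
  have hΓ : 0 < Real.Gamma (1 / 2 - H) := Real.Gamma_pos_of_pos (by linarith)
  have hΓ' : 0 < Real.Gamma (H + 1 / 2) := Real.Gamma_pos_of_pos (by linarith)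
  rw [e1] at hI
  have hG : 0 < (1 / t) ^ (1 / 2 - H) * Real.Gamma (1 / 2 - H) :=
    mul_pos (Real.rpow_pos_of_pos (by positivity) _) hΓ
  have hint : IntegrableOn (fun u : ℝ => u ^ (-H - 1 / 2) * Real.exp (-(t * u))) (Ioi 0) := by
    by_contra hcon
    rw [integral_undef hcon] at hI
    linarith
  have e2 : (fun x => weightFun H x * Real.exp (-(x * t))) =
      fun x => cH H * (x ^ (-H - 1 / 2) * Real.exp (-(t * x))) := by
    ext x; unfold weightFun; rw [mul_comm x t]; ring
  rw [e2]
  refine ⟨hint.const_mul _, ?_⟩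
  rw [MeasureTheory.integral_const_mul, hI, cH, fracKernel, one_div t, Real.inv_rpow ht.le,
    ← Real.rpow_neg ht.le, neg_sub]
  generalize Real.Gamma (1 / 2 - H) = g at hΓ
  field_simp

lemma integral_weightFun {H L : ℝ} (hH' : H < 1 / 2) :
    IntervalIntegrable (weightFun H) volume 0 L ∧
      ∫ x in (0 : ℝ)..L, weightFun H x = cH H / (1 / 2 - H) * L ^ (1 / 2 - H) := by
  refine ⟨(intervalIntegral.intervalIntegrable_rpow' (by linarith)).const_mul _, ?_⟩
  unfold weightFun
  rw [intervalIntegral.integral_const_mul, integral_rpow (Or.inl (by linarith)),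
    show -H - 1 / 2 + 1 = 1 / 2 - H by ring, Real.zero_rpow (by linarith : 1 / 2 - H ≠ 0)]
  ring

section Rule

variable {H T : ℝ} {N m n : ℕ}

lemma bigA_pos (hH : 0 < H) (hH' : H < 1 / 2) : 0 < bigA H :=
  Real.sqrt_pos.2 (add_pos (one_div_pos.2 hH) (one_div_pos.2 (by linarith)))

lemma one_lt_expAB : 1 < expAB :=
  Real.one_lt_exp_iff.2 (by norm_num [alpha, beta])

/-- The ratio of consecutive grid points. -/
noncomputable def gridRatio (H T : ℝ) (N n : ℕ) : ℝ := (xiRight H T N / xiLeft H T N) ^ ((1 : ℝ) / n)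

lemma xi_succ (hL : 0 < xiLeft H T N) (hLR : xiLeft H T N < xiRight H T N) (i : ℕ) :
    xi H T N n (i + 1) = gridRatio H T N n * xi H T N n i := by
  unfold xi gridRatio
  have : 0 < xiRight H T N / xiLeft H T N := div_pos (hL.trans hLR) hL
  rw [show ((i + 1 : ℕ) : ℝ) / (n : ℝ) = (1 : ℝ) / n + (i : ℝ) / n by push_cast; ring,
    Real.rpow_add this]
  ring

lemma xi_zero : xi H T N n 0 = xiLeft H T N := by simp [xi]

lemma xi_last (hL : 0 < xiLeft H T N) (hn : 1 ≤ n) : xi H T N n n = xiRight H T N := by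
  have : (n : ℝ) ≠ 0 := by positivity
  rw [xi, div_self this, Real.rpow_one, mul_div_cancel₀ _ hL.ne']

lemma xi_pos (hL : 0 < xiLeft H T N) (hLR : xiLeft H T N < xiRight H T N) (i : ℕ) :
    0 < xi H T N n i :=
  mul_pos hL (Real.rpow_pos_of_pos (div_pos (hL.trans hLR) hL) _)

lemma one_lt_gridRatio (hL : 0 < xiLeft H T N) (hLR : xiLeft H T N < xiRight H T N) (hn : 1 ≤ n) :
    1 < gridRatio H T N n :=
  Real.one_lt_rpow ((one_lt_div hL).2 hLR) (by positivity)

lemma xi_lt_succ (hL : 0 < xiLeft H T N) (hLR : xiLeft H T N < xiRight H T N) (hn : 1 ≤ n) (i : ℕ) :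
    xi H T N n i < xi H T N n (i + 1) := by
  rw [xi_succ hL hLR]
  exact lt_mul_of_one_lt_left (xi_pos hL hLR i) (one_lt_gridRatio hL hLR hn)

lemma integrable_weight_exp (hH : 0 < H) (hH' : H < 1 / 2) {t a b : ℝ} (ht : 0 < t) (ha : 0 ≤ a)
    (hb : 0 ≤ b) :
    IntervalIntegrable (fun x => weightFun H x * Real.exp (-(x * t))) volume a b := by
  have h := (laplace_weightFun hH hH' ht).1
  have h0 : ∀ c : ℝ, 0 ≤ c →
      IntervalIntegrable (fun x => weightFun H x * Real.exp (-(x * t))) volume 0 c := fun c hc =>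
    (intervalIntegrable_iff_integrableOn_Ioc_of_le hc).2 (h.mono_set Ioc_subset_Ioi_self)
  exact (h0 a ha).symm.trans (h0 b hb)

lemma sum_integral_xi (hH : 0 < H) (hH' : H < 1 / 2) (hL : 0 < xiLeft H T N)
    (hLR : xiLeft H T N < xiRight H T N) (hn : 1 ≤ n) {t : ℝ} (ht : 0 < t) :
    ∑ i : Fin n, ∫ x in (xi H T N n i)..(xi H T N n (i + 1)),
      weightFun H x * Real.exp (-(x * t)) =
    ∫ x in (xiLeft H T N)..(xiRight H T N), weightFun H x * Real.exp (-(x * t)) := by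
  rw [← xi_zero (n := n), ← xi_last hL hn, ← intervalIntegral.sum_integral_adjacent_intervals
    (fun k _ => integrable_weight_exp hH hH' ht (xi_pos hL hLR k).le (xi_pos hL hLR (k + 1)).le),
    Finset.sum_range]

lemma integral_xi_le (hH : 0 < H) (hH' : H < 1 / 2) (hL : 0 < xiLeft H T N)
    (hLR : xiLeft H T N < xiRight H T N) {t : ℝ} (ht : 0 < t) :
    ∫ x in (xiLeft H T N)..(xiRight H T N), weightFun H x * Real.exp (-(x * t)) ≤
      fracKernel H t := by
  have h := laplace_weightFun hH hH' ht
  rw [← h.2, intervalIntegral.integral_of_le hLR.le]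
  apply setIntegral_mono_set h.1
  · filter_upwards [ae_restrict_mem measurableSet_Ioi] with x hx
    exact (mul_pos (weightFun_pos hH hH' hx) (Real.exp_pos _)).le
  · have : Ioc (xiLeft H T N) (xiRight H T N) ⊆ Ioi 0 := fun x hx => hL.trans hx.1
    exact this.eventuallyLE

/-- The added node at `0` has weight `∫ w` over `[0, ξ_0]`, so it replaces `e^(-xt)` by `1` there;
the loss is at most `xt`. -/
lemma head_error (hH : 0 < H) (hH' : H < 1 / 2) {L t : ℝ} (hL : 0 < L) (ht : 0 < t) :
    |(∫ x in (0 : ℝ)..L, weightFun H x) -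
      ∫ x in (0 : ℝ)..L, weightFun H x * Real.exp (-(x * t))| ≤
      t * L * ∫ x in (0 : ℝ)..L, weightFun H x := by
  have i1 := (integral_weightFun (L := L) hH').1
  have i2 := integrable_weight_exp hH hH' ht le_rfl hL.le
  rw [← intervalIntegral.integral_sub i1 i2, ← intervalIntegral.integral_const_mul,
    ← Real.norm_eq_abs]
  apply intervalIntegral.norm_integral_le_of_norm_le hL.le
  · refine Eventually.of_forall fun x hx => ?_
    have hw := weightFun_pos hH hH' hx.1
    have e : weightFun H x - weightFun H x * Real.exp (-(x * t)) =
      (1 - Real.exp (-(x * t))) * weightFun H x := by ring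
    have h1 := Real.add_one_le_exp (-(x * t))
    have h2 : Real.exp (-(x * t)) ≤ 1 :=
      Real.exp_le_one_iff.2 (neg_nonpos.2 (mul_nonneg hx.1.le ht.le))
    rw [e, Real.norm_eq_abs, abs_mul, abs_of_pos hw, abs_of_nonneg (by linarith)]
    gcongr
    have : x * t ≤ L * t := by gcongr; exact hx.2
    linarith
  · exact i1.const_mul _

/-- Half of the exponent is spent on the factor `e^(-Rt/2)`, which yields the rate in `R` after
integration in `t`; the other half keeps the Laplace integral finite. -/
lemma tail_bound (hH : 0 < H) (hH' : H < 1 / 2) {R t : ℝ} (hR : 0 < R) (ht : 0 < t) :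
    |∫ x in Ioi R, weightFun H x * Real.exp (-(x * t))| ≤
      Real.exp (-(R / 2 * t)) * fracKernel H (1 / 2 * t) := by
  have h := (laplace_weightFun hH hH' ht).1
  have h' := laplace_weightFun hH hH' (t := 1 / 2 * t) (by positivity)
  have hsub : Ioi R ⊆ Ioi 0 := Ioi_subset_Ioi hR.le
  have hnn : ∀ s : ℝ, ∀ x ∈ Ioi (0 : ℝ), 0 ≤ weightFun H x * Real.exp (-(x * s)) := fun s x hx =>
    (mul_pos (weightFun_pos hH hH' hx) (Real.exp_pos _)).le
  rw [abs_of_nonneg (setIntegral_nonneg measurableSet_Ioi fun x hx => hnn t x (hsub hx)),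
    ← h'.2, ← MeasureTheory.integral_const_mul]
  calc _ ≤ ∫ x in Ioi R, Real.exp (-(R / 2 * t)) *
        (weightFun H x * Real.exp (-(x * (1 / 2 * t)))) := by
        apply setIntegral_mono_on (h.mono_set hsub) ((h'.1.mono_set hsub).const_mul _)
          measurableSet_Ioi
        intro x hx
        have hw := weightFun_pos hH hH' (hsub hx)
        rw [mul_left_comm, ← Real.exp_add]
        gcongr
        have : R * t ≤ x * t := by gcongr; exact (mem_Ioi.1 hx).le
        linarith
    _ ≤ _ := by
        apply setIntegral_mono_set (h'.1.const_mul _) _ hsub.eventuallyLE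
        filter_upwards [ae_restrict_mem measurableSet_Ioi] with x hx
        exact mul_nonneg (Real.exp_pos _).le (hnn _ x hx)

variable {x v : Fin n → Fin m → ℝ}

lemma weightZero_eq (hH' : H < 1 / 2) :
    weightZero H T N = ∫ y in (0 : ℝ)..(xiLeft H T N), weightFun H y :=
  (integral_weightFun hH').2.symm

lemma weightZero_pos (hH : 0 < H) (hH' : H < 1 / 2) (hL : 0 < xiLeft H T N) :
    0 < weightZero H T N :=
  mul_pos (div_pos (cH_pos hH hH') (by linarith)) (Real.rpow_pos_of_pos hL _)

/-- Pointwise error of the approximating kernel. -/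
lemma approxKernel_error (hH : 0 < H) (hH' : H < 1 / 2) (hL : 0 < xiLeft H T N)
    (hLR : xiLeft H T N < xiRight H T N) (hn : 1 ≤ n) (hm : 1 ≤ m)
    (hG : IsGaussianRule H T N m n x v) {δ ε t : ℝ} (hε : 0 < ε) (hε1 : ε ≤ 1) (hδε : δ < ε)
    (hδ : gridRatio H T N n - 1 ≤ δ * (gridRatio H T N n + 1)) (ht : 0 < t) :
    |approxKernel H T N x v t - fracKernel H t| ≤ t * xiLeft H T N * weightZero H T N +
      2 * ε ^ (2 * m) * fracKernel H ((1 - δ / ε) / 2 * t) +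
      Real.exp (-(xiRight H T N / 2 * t)) * fracKernel H (1 / 2 * t) := by
  have hκ : 0 < (1 - δ / ε) / 2 := by
    have : δ / ε < 1 := by rwa [div_lt_one hε]
    linarith
  have hκt := mul_pos hκ ht
  set L := xiLeft H T N with hLd
  set R := xiRight H T N with hRd
  set f : ℝ → ℝ := fun y => weightFun H y * Real.exp (-(y * t)) with hf
  have hl := laplace_weightFun hH hH' ht
  have hR : 0 < R := hL.trans hLR
  have s1 : (∫ y in (0 : ℝ)..L, f y) + ∫ y in Ioi L, f y = ∫ y in Ioi 0, f y :=
    intervalIntegral.integral_interval_add_Ioi hl.1 (hl.1.mono_set (Ioi_subset_Ioi hL.le))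
  have s2 : (∫ y in L..R, f y) + ∫ y in Ioi R, f y = ∫ y in Ioi L, f y :=
    intervalIntegral.integral_interval_add_Ioi (hl.1.mono_set (Ioi_subset_Ioi hL.le))
      (hl.1.mono_set (Ioi_subset_Ioi hR.le))
  have hmid : |(∑ i, ∑ j, v i j * Real.exp (-(x i j * t))) - ∫ y in L..R, f y| ≤
      2 * ε ^ (2 * m) * fracKernel H ((1 - δ / ε) / 2 * t) := by
    rw [hf, ← sum_integral_xi hH hH' hL hLR hn ht, ← Finset.sum_sub_distrib]
    refine (Finset.abs_sum_le_sum_abs _ _).trans ?_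
    calc _ ≤ ∑ i : Fin n, 2 * ε ^ (2 * m) * ∫ y in (xi H T N n i)..(xi H T N n (i + 1)),
          weightFun H y * Real.exp (-(y * ((1 - δ / ε) / 2 * t))) := by
          refine Finset.sum_le_sum fun i _ => ?_
          have hxi := xi_pos (n := n) hL hLR i
          apply (hG i).exp_error_le hm hxi (xi_lt_succ hL hLR hn i)
            (continuousOn_weightFun H hxi)
            (fun y hy => weightFun_pos hH hH' (hxi.trans_le hy.1)) hε hε1 hδε.le _ ht.le
          rw [xi_succ hL hLR]
          have := mul_le_mul_of_nonneg_right hδ hxi.le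
          linarith
      _ = 2 * ε ^ (2 * m) * ∫ y in L..R,
          weightFun H y * Real.exp (-(y * ((1 - δ / ε) / 2 * t))) := by
          rw [← Finset.mul_sum, sum_integral_xi hH hH' hL hLR hn hκt]
      _ ≤ _ := by
          gcongr
          exact integral_xi_le hH hH' hL hLR hκt
  have hhead := head_error hH hH' hL ht
  have htail := tail_bound hH hH' hR ht
  rw [← weightZero_eq hH'] at hhead
  have hdec : approxKernel H T N x v t - fracKernel H t =
      (weightZero H T N - ∫ y in (0 : ℝ)..L, f y) +
      ((∑ i, ∑ j, v i j * Real.exp (-(x i j * t))) - ∫ y in L..R, f y) -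
      ∫ y in Ioi R, f y := by
    rw [approxKernel, ← hl.2]
    linarith
  rw [hdec]
  refine (abs_sub _ _).trans ?_
  have := abs_add_le (weightZero H T N - ∫ y in (0 : ℝ)..L, f y)
    ((∑ i, ∑ j, v i j * Real.exp (-(x i j * t))) - ∫ y in L..R, f y)
  linarith

/-- Crude bound of the approximating kernel, valid for every `N`. -/
lemma approxKernel_le (hH : 0 < H) (hH' : H < 1 / 2) (hL : 0 < xiLeft H T N)
    (hLR : xiLeft H T N < xiRight H T N) (hm : 1 ≤ m)
    (hG : IsGaussianRule H T N m n x v) {r t : ℝ} (hr : 0 < r)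
    (hrn : 1 ≤ n → gridRatio H T N n ≤ r) (ht : 0 < t) :
    approxKernel H T N x v t ≤ weightZero H T N + fracKernel H (1 / r * t) := by
  have ht' : 0 < 1 / r * t := by positivity
  unfold approxKernel
  gcongr
  rcases Nat.eq_zero_or_pos n with hn | hn
  · subst hn
    rw [Finset.univ_eq_empty, Finset.sum_empty]
    exact ((logConvexKernel_fracKernel hH hH').pos _ ht').le
  · refine le_trans ?_ (integral_xi_le hH hH' hL hLR ht')
    rw [← sum_integral_xi hH hH' hL hLR hn ht']
    refine Finset.sum_le_sum fun i _ => ?_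
    have hxi := xi_pos (n := n) hL hLR i
    have := (hG i).exp_sum_le hm (xi_lt_succ hL hLR hn i) (continuousOn_weightFun H hxi)
      (fun y hy => weightFun_pos hH hH' (hxi.trans_le hy.1)) hr
      (by rw [xi_succ hL hLR]; gcongr; exact hrn hn) ht.le
    rwa [show t / r = 1 / r * t by ring] at this

lemma logConvexKernel_approxKernel (hH : 0 < H) (hH' : H < 1 / 2) (hL : 0 < xiLeft H T N)
    (hLR : xiLeft H T N < xiRight H T N) (hG : IsGaussianRule H T N m n x v) :
    LogConvexKernel (approxKernel H T N x v) := by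
  have hw : ∀ i j, 0 < v i j := fun i j => by
    have hn : 1 ≤ n := i.pos
    have hxi := xi_pos (n := n) hL hLR i
    exact (hG i).weight_pos (xi_lt_succ hL hLR hn i) (continuousOn_weightFun H hxi)
      (fun y hy => weightFun_pos hH hH' (hxi.trans_le hy.1)) j
  have hx : ∀ i j, 0 < x i j := fun i j => (xi_pos hL hLR i).trans_le ((hG i).1 j).1
  have h0 := weightZero_pos hH hH' hL
  -- `none` indexes the additional node `0`. Its positive weight keeps the kernel positive even when
  -- `n = 0`.
  have := logConvexKernel_sum_exp (ι := Option (Fin n × Fin m))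
    (fun o => o.elim (weightZero H T N) fun p => v p.1 p.2)
    (fun o => o.elim 0 fun p => x p.1 p.2)
    (by rintro (_ | p); exacts [h0.le, (hw _ _).le])
    (by rintro (_ | p); exacts [le_rfl, (hx _ _).le]) ⟨none, h0⟩
  convert this using 2 with t
  simp [approxKernel, Fintype.sum_option, Fintype.sum_prod_type]

lemma continuous_approxKernel : Continuous (approxKernel H T N x v) := by
  unfold approxKernel; fun_prop

end Rule

end RoughHeston

namespace RoughHeston

/-! Numerical constants -/

lemma exp_le_taylor {y : ℝ} (h0 : 0 ≤ y) (h1 : y ≤ 1) :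
    Real.exp y ≤ 1 + y + y ^ 2 / 2 + y ^ 3 / 6 + y ^ 4 / 24 * (5 / 4) := by
  have := Real.exp_bound' h0 h1 (n := 4) (by norm_num)
  simp only [Finset.sum_range_succ, Finset.sum_range_zero, Nat.factorial] at this
  norm_num at this
  linarith

lemma expAB_le : expAB ≤ 1.58 := by
  have h := exp_le_taylor (y := alpha * beta) (by norm_num [alpha, beta]) (by norm_num [alpha, beta])
  refine h.trans ?_
  norm_num [alpha, beta]

/-- A grid ratio of at most `1.77` gives `(r - 1)/(r + 1) ≤ 0.28`, the value of `δ` used for the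
quadrature. -/
lemma exp_ratio_le : Real.exp 0.55 ≤ 1.77 :=
  (exp_le_taylor (by norm_num) (by norm_num)).trans (by norm_num)

/-- The quadrature rate `ε = e^(-1.245)` must exceed `δ = 0.28`; the choice `2 · 1.245 = 2.49` is
dictated by `2.49 β ≥ α`. -/
lemma lt_exp_rate : 0.28 < Real.exp (-1.245) := by
  have h := exp_le_taylor (y := 0.6225) (by norm_num) (by norm_num)
  have h2 : Real.exp 0.6225 ≤ 1.87 := h.trans (by norm_num)
  have h3 : Real.exp 1.245 ≤ 3.5 := by
    rw [show (1.245 : ℝ) = 0.6225 + 0.6225 by norm_num, Real.exp_add]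
    have := Real.exp_pos 0.6225
    nlinarith
  rw [Real.exp_neg, lt_inv_comm₀ (by norm_num) (Real.exp_pos _)]
  refine h3.trans_lt (by norm_num)

/-! ### Asymptotics of the grid in `N`. -/

section

variable {H T : ℝ}

lemma gam_inv_ge (hH : 0 < H) (hH' : H < 1 / 2) :
    1.01 + 6 * H - 4 * H ^ 2 ≤ 3 * expAB / (8 * (expAB - 1)) + 6 * H - 4 * H ^ 2 := by
  have h1 := one_lt_expAB
  have h2 := expAB_le
  have : 1.01 ≤ 3 * expAB / (8 * (expAB - 1)) := by
    rw [le_div_iff₀ (by linarith)]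
    linarith
  linarith

lemma gam_pos (hH : 0 < H) (hH' : H < 1 / 2) : 0 < gam H := by
  have := gam_inv_ge hH hH'
  apply inv_pos.2
  nlinarith

/-- The power of `N` in the error of the left end. -/
lemma left_exponent_le (hH : 0 < H) (hH' : H < 1 / 2) :
    (1 - H) * (2 * H) * gam H * (3 / 2 - H) ≤ 0.21 := by
  have h := gam_inv_ge hH hH'
  have hp : 0 < 1.01 + 6 * H - 4 * H ^ 2 := by nlinarith
  have hg : gam H ≤ (1.01 + 6 * H - 4 * H ^ 2)⁻¹ := inv_anti₀ hp h
  have hc : 0 ≤ (1 - H) * (2 * H) * (3 / 2 - H) := by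
    apply mul_nonneg (mul_nonneg _ _) <;> linarith
  calc _ = (1 - H) * (2 * H) * (3 / 2 - H) * gam H := by ring
    _ ≤ (1 - H) * (2 * H) * (3 / 2 - H) * (1.01 + 6 * H - 4 * H ^ 2)⁻¹ := by gcongr
    _ ≤ 0.21 := by
      rw [← div_eq_mul_inv, div_le_iff₀ hp]
      -- The quotient peaks near `H = 0.26` with value about `0.2075`, hence the hints and the
      -- exponent `0.21`.
      nlinarith [sq_nonneg (H - 0.26), mul_nonneg hH.le (sq_nonneg (H - 0.26)),
        mul_nonneg (by linarith : 0 ≤ 1 / 2 - H) (sq_nonneg (H - 0.26))]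

lemma rpow_scaling {c1 c2 T N e s g : ℝ} (h1 : 0 < c1) (h2 : 0 < c2) (hN : 0 < N) :
    T⁻¹ * (c1 * (c2 * N ^ e) ^ s) ^ g = T⁻¹ * (c1 * c2 ^ s) ^ g * N ^ (e * s * g) := by
  have hNe := Real.rpow_pos_of_pos hN e
  rw [Real.mul_rpow h2.le hNe.le, ← mul_assoc c1, Real.mul_rpow (by positivity) (by positivity),
    ← Real.rpow_mul hN.le, ← Real.rpow_mul hN.le]
  ring

lemma exists_ruleA_eq (hH : 0 < H) (hH' : H < 1 / 2) (hT : 0 < T) :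
    ∃ c, 0 < c ∧ ∀ N : ℕ, 1 ≤ N → ruleA H T N = c * (N : ℝ) ^ ((1 - H) * (2 * H) * gam H) := by
  have hE := one_lt_expAB
  have hA := bigA_pos hH hH'
  have h1 : 0 < ((9 - 6 * H) / (2 * H)) ^ (expAB / (8 * (expAB - 1))) :=
    Real.rpow_pos_of_pos (div_pos (by linarith) (by linarith)) _
  have h2 : 0 < 5 * Real.pi ^ 3 / 768 * expAB * (expAB - 1) *
      (bigA H ^ (2 - 2 * H) * (3 - 2 * H) / (beta ^ (2 - 2 * H) * H)) := by
    have hb : 0 < beta ^ (2 - 2 * H) := Real.rpow_pos_of_pos (by norm_num [beta]) _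
    have hA' := Real.rpow_pos_of_pos hA (2 - 2 * H)
    have hpi := Real.pi_pos
    have : 0 < 3 - 2 * H := by linarith
    have : 0 < expAB - 1 := by linarith
    positivity
  refine ⟨_, ?_, fun N hN => rpow_scaling h1 h2 (by exact_mod_cast hN)⟩
  positivity

lemma exists_ruleB_eq (hH : 0 < H) (hH' : H < 1 / 2) (hT : 0 < T) :
    ∃ c, 0 < c ∧ ∀ N : ℕ, 1 ≤ N →
      ruleB H T N = c * (N : ℝ) ^ ((1 - H) * (2 * H - 3) * gam H) := by
  have hE := one_lt_expAB
  have hA := bigA_pos hH hH'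
  have h1 : 0 < ((9 - 6 * H) / (2 * H)) ^ (expAB / (8 * (expAB - 1))) :=
    Real.rpow_pos_of_pos (div_pos (by linarith) (by linarith)) _
  have h2 : 0 < 5 * Real.pi ^ 3 / 1152 * expAB * (expAB - 1) *
      (bigA H ^ (2 - 2 * H) / beta ^ (2 - 2 * H)) := by
    have hb : 0 < beta ^ (2 - 2 * H) := Real.rpow_pos_of_pos (by norm_num [beta]) _
    have hA' := Real.rpow_pos_of_pos hA (2 - 2 * H)
    have hpi := Real.pi_pos
    have : 0 < expAB - 1 := by linarith
    positivity
  refine ⟨_, ?_, fun N hN => rpow_scaling h1 h2 (by exact_mod_cast hN)⟩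
  positivity

lemma exists_rpow_mul_exp_le (p : ℝ) {c : ℝ} (hc : 0 < c) :
    ∃ B : ℝ, ∀ N : ℕ, (N : ℝ) ^ p * Real.exp (-(c * Real.sqrt N)) ≤ B := by
  have h1 := (tendsto_rpow_mul_exp_neg_mul_atTop_nhds_zero (2 * p) c hc).comp
    (Real.tendsto_sqrt_atTop.comp tendsto_natCast_atTop_atTop)
  obtain ⟨B, hB⟩ := h1.bddAbove_range
  refine ⟨B, fun N => ?_⟩
  have h2 := hB ⟨N, rfl⟩
  simp only [Function.comp] at h2
  rwa [Real.rpow_mul (Real.sqrt_nonneg _), Real.rpow_two, Real.sq_sqrt (Nat.cast_nonneg N),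
    neg_mul] at h2

lemma xiLeft_pos (hH : 0 < H) (hH' : H < 1 / 2) (hT : 0 < T) {N : ℕ} (hN : 1 ≤ N) :
    0 < xiLeft H T N := by
  obtain ⟨c, hc, h⟩ := exists_ruleA_eq hH hH' hT
  rw [xiLeft, h N hN]
  have : (0 : ℝ) < N := by exact_mod_cast hN
  positivity

lemma exists_xiLeft_le (hH : 0 < H) (hH' : H < 1 / 2) (hT : 0 < T) :
    ∃ B, 0 < B ∧ ∀ N : ℕ, 1 ≤ N → xiLeft H T N ≤ B := by
  obtain ⟨c, hc, h⟩ := exists_ruleA_eq hH hH' hT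
  have hA := bigA_pos hH hH'
  have h3 : 0 < 3 / 2 - H := by linarith
  have hα : 0 < alpha := by norm_num [alpha]
  obtain ⟨B, hB⟩ := exists_rpow_mul_exp_le ((1 - H) * (2 * H) * gam H)
    (c := alpha / ((3 / 2 - H) * bigA H)) (by positivity)
  refine ⟨c * max B 1, by positivity, fun N hN => ?_⟩
  rw [xiLeft, h N hN, mul_assoc]
  gcongr
  exact (hB N).trans (le_max_left _ _)

lemma exists_xiLeft_rpow_le (hH : 0 < H) (hH' : H < 1 / 2) (hT : 0 < T) :
    ∃ C, 0 < C ∧ ∀ N : ℕ, 1 ≤ N → xiLeft H T N ^ (3 / 2 - H) ≤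
      C * ((N : ℝ) ^ (0.21 : ℝ) * Real.exp (-(alpha / bigA H * Real.sqrt N))) := by
  obtain ⟨c, hc, h⟩ := exists_ruleA_eq hH hH' hT
  have hA := bigA_pos hH hH'
  have h3 : 0 < 3 / 2 - H := by linarith
  refine ⟨c ^ (3 / 2 - H), by positivity, fun N hN => ?_⟩
  have hN1 : (1 : ℝ) ≤ N := by exact_mod_cast hN
  have hN0 : (0 : ℝ) ≤ N := by linarith
  rw [xiLeft, h N hN, Real.mul_rpow (by positivity) (Real.exp_pos _).le,
    Real.mul_rpow hc.le (by positivity), ← Real.rpow_mul hN0, ← Real.exp_mul, mul_assoc]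
  gcongr
  · exact left_exponent_le hH hH'
  · apply le_of_eq
    generalize 3 / 2 - H = c3 at h3
    field_simp

/-- The exponent equals `α/A + α/(2HA)`: the surplus `exp(-α√N/(2HA))` absorbs whatever power of `N`
comes from `ruleB`. -/
lemma exists_xiRight_rpow_le (hH : 0 < H) (hH' : H < 1 / 2) (hT : 0 < T) :
    ∃ C, 0 < C ∧ ∀ N : ℕ, 1 ≤ N → xiRight H T N ^ (-(H + 1 / 2)) ≤
      C * ((N : ℝ) ^ (0.21 : ℝ) * Real.exp (-(alpha / bigA H * Real.sqrt N))) := by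
  obtain ⟨c, hc, h⟩ := exists_ruleB_eq hH hH' hT
  have hA := bigA_pos hH hH'
  have hα : 0 < alpha := by norm_num [alpha]
  obtain ⟨B, hB⟩ := exists_rpow_mul_exp_le ((1 - H) * (2 * H - 3) * gam H * (-(H + 1 / 2)))
    (c := alpha / (2 * H * bigA H)) (by positivity)
  refine ⟨c ^ (-(H + 1 / 2)) * max B 1, by positivity, fun N hN => ?_⟩
  have hN1 : (1 : ℝ) ≤ N := by exact_mod_cast hN
  have hN0 : (0 : ℝ) ≤ N := by linarith
  rw [xiRight, h N hN, Real.mul_rpow (by positivity) (Real.exp_pos _).le,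
    Real.mul_rpow hc.le (by positivity), ← Real.rpow_mul hN0, ← Real.exp_mul,
    mul_assoc (c ^ _), mul_assoc (c ^ _)]
  refine mul_le_mul_of_nonneg_left ?_ (by positivity)
  have e : alpha / (H * bigA H) * Real.sqrt N * (-(H + 1 / 2)) =
      -(alpha / (2 * H * bigA H) * Real.sqrt N) + -(alpha / bigA H * Real.sqrt N) := by
    field_simp; ring
  rw [e, Real.exp_add, ← mul_assoc]
  refine mul_le_mul ((hB N).trans (le_max_left B 1)) ?_ (Real.exp_pos _).le (by positivity)
  exact le_mul_of_one_le_left (Real.exp_pos _).le (Real.one_le_rpow hN1 (by norm_num))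

/-- The two exponents add up to `αA√N` because `A² = 1/H + 1/(3/2 - H)`. The powers of `N` can be
discarded since that of `ruleB` is the smaller one. -/
lemma exists_xi_ratio_le (hH : 0 < H) (hH' : H < 1 / 2) (hT : 0 < T) :
    ∃ c, 0 < c ∧ ∀ N : ℕ, 1 ≤ N → xiRight H T N / xiLeft H T N ≤
      Real.exp (alpha * bigA H * Real.sqrt N + c) := by
  obtain ⟨ca, hca, ha⟩ := exists_ruleA_eq hH hH' hT
  obtain ⟨cb, hcb, hb⟩ := exists_ruleB_eq hH hH' hT
  have hA := bigA_pos hH hH'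
  have hg := gam_pos hH hH'
  have h3 : 0 < 3 / 2 - H := by linarith
  refine ⟨cb / ca, by positivity, fun N hN => ?_⟩
  have hN1 : (1 : ℝ) ≤ N := by exact_mod_cast hN
  have hN0 : (0 : ℝ) < N := by linarith
  rw [div_le_iff₀ (xiLeft_pos hH hH' hT hN), xiRight, xiLeft, ha N hN, hb N hN]
  have e : Real.exp (alpha * bigA H * Real.sqrt N + cb / ca) *
      (ca * (N : ℝ) ^ ((1 - H) * (2 * H) * gam H) *
        Real.exp (-(alpha / ((3 / 2 - H) * bigA H) * Real.sqrt N))) =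
      (ca * Real.exp (cb / ca)) * (N : ℝ) ^ ((1 - H) * (2 * H) * gam H) *
        Real.exp (alpha / (H * bigA H) * Real.sqrt N) := by
    have e1 : alpha * bigA H * Real.sqrt N = alpha / (H * bigA H) * Real.sqrt N +
        alpha / ((3 / 2 - H) * bigA H) * Real.sqrt N := by
      have : bigA H ^ 2 = 1 / H + 1 / (3 / 2 - H) := Real.sq_sqrt (by positivity)
      have e2 : bigA H = (1 / H + 1 / (3 / 2 - H)) / bigA H := by
        rw [← this, sq, mul_div_assoc, div_self hA.ne', mul_one]
      calc alpha * bigA H * Real.sqrt N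
          = alpha * ((1 / H + 1 / (3 / 2 - H)) / bigA H) * Real.sqrt N := by rw [← e2]
        _ = _ := by field_simp
    rw [e1, Real.exp_add, Real.exp_add, Real.exp_neg]
    field_simp
  rw [e]
  have hc : cb ≤ ca * Real.exp (cb / ca) := by
    have := Real.add_one_le_exp (cb / ca)
    calc cb = ca * (cb / ca) := by field_simp
      _ ≤ _ := by gcongr; linarith
  have hp : (N : ℝ) ^ ((1 - H) * (2 * H - 3) * gam H) ≤ (N : ℝ) ^ ((1 - H) * (2 * H) * gam H) := by
    apply Real.rpow_le_rpow_of_exponent_le hN1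
    have : 0 ≤ (1 - H) * gam H := mul_nonneg (by linarith) hg.le
    nlinarith
  gcongr

/-- The competitor `k = N / m`, rounded down, misses `N` by at most `m`. -/
lemma IsLevelAndCount.le_mul {N m n : ℕ} (h : IsLevelAndCount H N m n) :
    (N : ℝ) - m ≤ n * m := by
  have hm := h.1
  have h1 := h.2.2 (N / m)
  have h2 : ((N / m : ℕ) : ℝ) * m + ((N % m : ℕ) : ℝ) = N := by
    have := Nat.div_add_mod N m
    rw [mul_comm] at this
    exact_mod_cast this
  have h3 : ((N % m : ℕ) : ℝ) ≤ m := by exact_mod_cast (Nat.mod_lt N hm).le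
  have h4 : |((N / m : ℕ) : ℝ) * m - N| ≤ m := by
    rw [abs_le]
    have : (0 : ℝ) ≤ ((N % m : ℕ) : ℝ) := Nat.cast_nonneg _
    constructor <;> linarith
  have := (abs_le.1 (h1.trans h4)).1
  linarith

/-- For large `N` the grid ratio is close to `e^(αβ)`; a numerical bound suffices. -/
lemma exists_gridRatio_le (hH : 0 < H) (hH' : H < 1 / 2) (hT : 0 < T) :
    ∃ N0 : ℕ, ∀ N m n : ℕ, 1 ≤ N → N0 ≤ N → xiLeft H T N < xiRight H T N →
      IsLevelAndCount H N m n → 1 ≤ n ∧ gridRatio H T N n ≤ Real.exp 0.55 := by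
  obtain ⟨c, hc, hratio⟩ := exists_xi_ratio_le hH hH' hT
  have hA := bigA_pos hH hH'
  have hα : 0 < alpha := by norm_num [alpha]
  have hβ : 0 < beta := by norm_num [beta]
  -- `k` collects the lower-order terms of `(αAσ + c + 0.55) m`, with `m ≤ βσ/A + 1`. Since `αβ ≤
  -- 0.455`, requiring `k ≤ 0.09 σ` keeps the total below `0.55 σ²`.
  set k := alpha * bigA H + (c + 0.55) * (beta / bigA H) + (c + 0.55) with hk
  have hk0 : 0 < k := by positivity
  refine ⟨⌈(1 + k / 0.09) ^ 2⌉₊, fun N m n hN hN0 hLR hmn => ?_⟩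
  have hL := xiLeft_pos hH hH' hT hN
  set σ := Real.sqrt N with hσ
  have hσN : σ ^ 2 = N := Real.sq_sqrt (Nat.cast_nonneg N)
  have hσk : 1 + k / 0.09 ≤ σ := by
    apply Real.le_sqrt_of_sq_le
    exact (Nat.le_ceil _).trans (by exact_mod_cast hN0)
  have hk9 : 0 < k / 0.09 := by positivity
  have hσ1 : 1 ≤ σ := by linarith
  have hkσ : k ≤ 0.09 * σ := by
    have : k / 0.09 ≤ σ := by linarith
    rw [div_le_iff₀ (by norm_num)] at this
    linarith
  have hm0 : (0 : ℝ) < m := by exact_mod_cast hmn.1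
  have hmle : (m : ℝ) ≤ beta / bigA H * σ + 1 := by
    have := (abs_lt.1 hmn.2.1).2
    linarith
  have hnm := hmn.le_mul
  have key : (alpha * bigA H * σ + c) * m ≤ 0.55 * n * m := by
    have h1 : (alpha * bigA H * σ + (c + 0.55)) * m ≤
        (alpha * bigA H * σ + (c + 0.55)) * (beta / bigA H * σ + 1) := by gcongr
    have h2 : (alpha * bigA H * σ + (c + 0.55)) * (beta / bigA H * σ + 1) =
        alpha * beta * σ ^ 2 + (alpha * bigA H + (c + 0.55) * (beta / bigA H)) * σ +
          (c + 0.55) := by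
      field_simp
      ring
    have h3 : (alpha * bigA H + (c + 0.55) * (beta / bigA H)) * σ + (c + 0.55) ≤ k * σ := by
      rw [hk]; nlinarith
    have h4 : k * σ ≤ 0.09 * σ ^ 2 := by nlinarith
    have h5 : alpha * beta ≤ 0.455 := by norm_num [alpha, beta]
    have h6 : alpha * beta * σ ^ 2 ≤ 0.455 * σ ^ 2 := by gcongr
    nlinarith [sq_nonneg σ]
  have key' : alpha * bigA H * σ + c ≤ 0.55 * n := le_of_mul_le_mul_right key hm0
  have hn0 : (0 : ℝ) < n := by
    have : 0 < alpha * bigA H * σ := by positivity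
    linarith
  have hn : 1 ≤ n := by exact_mod_cast hn0
  refine ⟨hn, ?_⟩
  calc gridRatio H T N n ≤ (Real.exp (alpha * bigA H * σ + c)) ^ ((1 : ℝ) / n) := by
        apply Real.rpow_le_rpow (div_pos (hL.trans hLR) hL).le (hratio N hN) (by positivity)
    _ ≤ _ := by
        rw [← Real.exp_mul]
        gcongr
        rw [mul_one_div, div_le_iff₀ hn0]
        exact key'

lemma exists_gridRatio_bound (hH : 0 < H) (hH' : H < 1 / 2) (hT : 0 < T) :
    ∃ r : ℝ, 0 < r ∧ ∀ N m n : ℕ, 1 ≤ N → xiLeft H T N < xiRight H T N →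
      IsLevelAndCount H N m n → 1 ≤ n → gridRatio H T N n ≤ r := by
  obtain ⟨N0, h0⟩ := exists_gridRatio_le hH hH' hT
  obtain ⟨c, hc, hratio⟩ := exists_xi_ratio_le hH hH' hT
  have hA := bigA_pos hH hH'
  have hα : 0 < alpha := by norm_num [alpha]
  -- For the finitely many small `N`, the whole quotient `ξ_n / ξ_0` bounds the grid ratio.
  refine ⟨max (Real.exp 0.55) (Real.exp (alpha * bigA H * Real.sqrt N0 + c)), by positivity,
    fun N m n hN hLR hmn hn => ?_⟩
  rcases le_total N0 N with h | h
  · exact (h0 N m n hN h hLR hmn).2.trans (le_max_left _ _)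
  · refine le_trans ?_ (le_max_right _ _)
    have hL := xiLeft_pos hH hH' hT hN
    have h1 : 1 ≤ xiRight H T N / xiLeft H T N := ((one_lt_div hL).2 hLR).le
    have h2 : (1 : ℝ) / n ≤ 1 := by
      rw [div_le_one (by exact_mod_cast hn)]
      exact_mod_cast hn
    calc gridRatio H T N n ≤ (xiRight H T N / xiLeft H T N) ^ (1 : ℝ) :=
          Real.rpow_le_rpow_of_exponent_le h1 h2
      _ ≤ _ := by
          rw [Real.rpow_one]
          refine (hratio N hN).trans ?_
          gcongr

/-- Since `m > β√N/A - 1`, the rounding costs the constant `e^2.49`, and `2.49 β ≥ α` gives the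
rate. -/
lemma level_rate (hH : 0 < H) (hH' : H < 1 / 2) {N m n : ℕ} (hN : 1 ≤ N)
    (hmn : IsLevelAndCount H N m n) :
    Real.exp (-1.245) ^ (2 * m) ≤
      Real.exp 2.49 * ((N : ℝ) ^ (0.21 : ℝ) * Real.exp (-(alpha / bigA H * Real.sqrt N))) := by
  have hA := bigA_pos hH hH'
  have hN1 : (1 : ℝ) ≤ N := by exact_mod_cast hN
  have h1 : Real.exp (-1.245) ^ (2 * m) ≤
      Real.exp 2.49 * Real.exp (-(alpha / bigA H * Real.sqrt N)) := by
    rw [← Real.exp_nat_mul, ← Real.exp_add]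
    apply Real.exp_le_exp.2
    have := (abs_lt.1 hmn.2.1).1
    have h2 : alpha / bigA H * Real.sqrt N ≤ 2.49 * (beta / bigA H * Real.sqrt N) := by
      rw [← mul_assoc, ← mul_div_assoc]
      gcongr
      norm_num [alpha, beta]
    push_cast
    linarith
  refine h1.trans ?_
  gcongr
  exact le_mul_of_one_le_left (Real.exp_pos _).le (Real.one_le_rpow hN1 (by norm_num))

end

end RoughHeston

/-! ### `L¹` error, uniform domination and the rate. -/

namespace RoughHeston

variable {H T : ℝ}

lemma integral_fracKernel_exp_le (hH : 0 < H) (hH' : H < 1 / 2) {θ t : ℝ} (hθ : 0 < θ)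
    (ht : 0 ≤ t) :
    ∫ u in (0 : ℝ)..t, fracKernel H u * Real.exp (-(θ * u)) ≤ θ ^ (-(H + 1 / 2)) := by
  have hΓ : 0 < Real.Gamma (H + 1 / 2) := Real.Gamma_pos_of_pos (by linarith)
  have := (logConvexKernel_fracKernel hH hH').laplace_le (T := t)
    (C0 := (Real.Gamma (H + 1 / 2))⁻¹) hH (by positivity) hθ
    (fun s _ => le_of_eq (by unfold fracKernel; ring)) ⟨ht, le_rfl⟩
  refine this.trans (le_of_eq ?_)
  rw [one_div θ, Real.inv_rpow hθ.le, ← Real.rpow_neg hθ.le]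
  field_simp

/-- `L¹` error of the approximating kernel in terms of the grid. -/
lemma exists_L1_error_le (hH : 0 < H) (hH' : H < 1 / 2) {δ ε : ℝ} (hε : 0 < ε)
    (hε1 : ε ≤ 1) (hδε : δ < ε) :
    ∃ C, 0 < C ∧ ∀ (N m n : ℕ) (x v : Fin n → Fin m → ℝ), 0 < xiLeft H T N →
      xiLeft H T N < xiRight H T N → 1 ≤ n → 1 ≤ m → IsGaussianRule H T N m n x v →
      gridRatio H T N n - 1 ≤ δ * (gridRatio H T N n + 1) → ∀ t ∈ Icc 0 T,
      ∫ u in (0 : ℝ)..t, |approxKernel H T N x v u - fracKernel H u| ≤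
        C * (xiLeft H T N ^ (3 / 2 - H) + ε ^ (2 * m) + xiRight H T N ^ (-(H + 1 / 2))) := by
  have hKG := logConvexKernel_fracKernel hH hH'
  have hκ : 0 < (1 - δ / ε) / 2 := by
    have : δ / ε < 1 := by rwa [div_lt_one hε]
    linarith
  set κ := (1 - δ / ε) / 2 with hκd
  set I := ∫ u in (0 : ℝ)..T, fracKernel H u with hI
  set c0 := cH H / (1 / 2 - H) with hc0
  have hc0p : 0 < c0 := div_pos (cH_pos hH hH') (by linarith)
  have hhalf : 0 < (1 / 2 : ℝ) ^ (H - 1 / 2) := by positivity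
  have hmono : ∀ t ∈ Icc 0 T, ∫ u in (0 : ℝ)..t, fracKernel H u ≤ I := by
    intro t ht
    apply intervalIntegral.integral_mono_interval le_rfl ht.1 ht.2 _ (hKG.integrable T)
    filter_upwards [ae_restrict_mem measurableSet_Ioc] with u hu
    exact (hKG.pos u hu.1).le
  set C := T * T * c0 + 2 * (κ ^ (H - 1 / 2) * I) +
    (1 / 2 : ℝ) ^ (H - 1 / 2) * (1 / 2 : ℝ) ^ (-(H + 1 / 2)) with hC
  by_cases hT : 0 ≤ T
  swap
  · exact ⟨1, one_pos, fun N m n x v _ _ _ _ _ _ t ht => absurd (ht.1.trans ht.2) hT⟩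
  have hI0 : 0 ≤ I := by
    have := hmono 0 ⟨le_rfl, hT⟩
    rwa [intervalIntegral.integral_same] at this
  refine ⟨C, by positivity, fun N m n x v hL hLR hn hm hG hδ t ht => ?_⟩
  have hR := hL.trans hLR
  have hKh := logConvexKernel_approxKernel hH hH' hL hLR hG
  set L := xiLeft H T N with hLd
  set R := xiRight H T N with hRd
  have hw0 := weightZero_pos hH hH' hL
  have hLw : L * weightZero H T N = c0 * L ^ (3 / 2 - H) := by
    rw [weightZero, ← hc0, ← hLd, show 3 / 2 - H = (1 / 2 - H) + 1 by ring,
      Real.rpow_add_one hL.ne']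
    ring
  have i1 := hKG.integrable t
  have i2 := hKG.integrable_exp (R / 2) 0 t
  have hbound : ∀ u ∈ Ioc 0 t, |approxKernel H T N x v u - fracKernel H u| ≤
      T * (L * weightZero H T N) + 2 * ε ^ (2 * m) * κ ^ (H - 1 / 2) * fracKernel H u +
        (1 / 2 : ℝ) ^ (H - 1 / 2) * (fracKernel H u * Real.exp (-(R / 2 * u))) := by
    intro u hu
    have h := approxKernel_error hH hH' hL hLR hn hm hG hε hε1 hδε hδ hu.1
    -- Homogeneity of `fracKernel` turns the slowed times `κu` and `u/2` into constant factors.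
    rw [← hκd, fracKernel_mul hκ.le hu.1.le, fracKernel_mul (by norm_num) hu.1.le,
      ← hLd, ← hRd] at h
    have : u * (L * weightZero H T N) ≤ T * (L * weightZero H T N) := by
      gcongr; exact hu.2.trans ht.2
    linarith
  have hint : ∫ u in (0 : ℝ)..t, |approxKernel H T N x v u - fracKernel H u| ≤
      ∫ u in (0 : ℝ)..t, (T * (L * weightZero H T N) +
        2 * ε ^ (2 * m) * κ ^ (H - 1 / 2) * fracKernel H u +
        (1 / 2 : ℝ) ^ (H - 1 / 2) * (fracKernel H u * Real.exp (-(R / 2 * u)))) := by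
    rw [intervalIntegral.integral_of_le ht.1, intervalIntegral.integral_of_le ht.1]
    apply setIntegral_mono_on _ _ measurableSet_Ioc hbound
    · exact (intervalIntegrable_iff_integrableOn_Ioc_of_le ht.1).1
        ((hKh.integrable t).sub i1).abs
    · exact (intervalIntegrable_iff_integrableOn_Ioc_of_le ht.1).1
        ((intervalIntegrable_const.add (i1.const_mul _)).add (i2.const_mul _))
  refine hint.trans ?_
  rw [intervalIntegral.integral_add (intervalIntegrable_const.add (i1.const_mul _))
    (i2.const_mul _), intervalIntegral.integral_add intervalIntegrable_const (i1.const_mul _),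
    intervalIntegral.integral_const, intervalIntegral.integral_const_mul,
    intervalIntegral.integral_const_mul, sub_zero, smul_eq_mul, hLw]
  have b1 : t * (T * (c0 * L ^ (3 / 2 - H))) ≤ C * L ^ (3 / 2 - H) := by
    have e1 : t * (T * (c0 * L ^ (3 / 2 - H))) = (t * T * c0) * L ^ (3 / 2 - H) := by ring
    have e2 : t * T * c0 ≤ T * T * c0 := by gcongr; exact ht.2
    have e3 : T * T * c0 ≤ C := by
      have : 0 ≤ 2 * (κ ^ (H - 1 / 2) * I) +
        (1 / 2 : ℝ) ^ (H - 1 / 2) * (1 / 2 : ℝ) ^ (-(H + 1 / 2)) := by positivity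
      linarith
    rw [e1]
    gcongr
    exact e2.trans e3
  have b2 : 2 * ε ^ (2 * m) * κ ^ (H - 1 / 2) * (∫ u in (0 : ℝ)..t, fracKernel H u) ≤
      C * ε ^ (2 * m) := by
    have e3 : 2 * (κ ^ (H - 1 / 2) * I) ≤ C := by
      have : 0 ≤ T * T * c0 + (1 / 2 : ℝ) ^ (H - 1 / 2) * (1 / 2 : ℝ) ^ (-(H + 1 / 2)) := by
        positivity
      linarith
    calc _ ≤ 2 * ε ^ (2 * m) * κ ^ (H - 1 / 2) * I := by gcongr; exact hmono t ht
      _ = (2 * (κ ^ (H - 1 / 2) * I)) * ε ^ (2 * m) := by ring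
      _ ≤ _ := by gcongr
  have b3 : (1 / 2 : ℝ) ^ (H - 1 / 2) *
      (∫ u in (0 : ℝ)..t, fracKernel H u * Real.exp (-(R / 2 * u))) ≤
      C * R ^ (-(H + 1 / 2)) := by
    have e1 := integral_fracKernel_exp_le hH hH' (θ := R / 2) (by positivity) ht.1
    rw [show R / 2 = (1 / 2) * R by ring, Real.mul_rpow (by norm_num) hR.le] at e1
    rw [show R / 2 = (1 / 2) * R by ring]
    have e3 : (1 / 2 : ℝ) ^ (H - 1 / 2) * (1 / 2 : ℝ) ^ (-(H + 1 / 2)) ≤ C := by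
      have : 0 ≤ T * T * c0 + 2 * (κ ^ (H - 1 / 2) * I) := by positivity
      linarith
    calc _ ≤ (1 / 2 : ℝ) ^ (H - 1 / 2) * ((1 / 2 : ℝ) ^ (-(H + 1 / 2)) * R ^ (-(H + 1 / 2))) := by
          gcongr
      _ = (1 / 2 : ℝ) ^ (H - 1 / 2) * (1 / 2 : ℝ) ^ (-(H + 1 / 2)) * R ^ (-(H + 1 / 2)) := by ring
      _ ≤ _ := by gcongr
  linarith

/-- Domination of the approximating kernels by a multiple of the fractional kernel, uniformly
in `N`. -/
lemma exists_approxKernel_le (hH : 0 < H) (hH' : H < 1 / 2) (hT : 0 < T) :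
    ∃ C, 0 < C ∧ ∀ (N m n : ℕ) (x v : Fin n → Fin m → ℝ), 1 ≤ N →
      xiLeft H T N < xiRight H T N → IsLevelAndCount H N m n → IsGaussianRule H T N m n x v →
      ∀ t ∈ Ioc 0 T, approxKernel H T N x v t ≤ C * t ^ (H - 1 / 2) := by
  obtain ⟨r, hr, hgrid⟩ := exists_gridRatio_bound hH hH' hT
  obtain ⟨B, hB, hleft⟩ := exists_xiLeft_le hH hH' hT
  have hΓ : 0 < Real.Gamma (H + 1 / 2) := Real.Gamma_pos_of_pos (by linarith)
  have hcH := cH_pos hH hH'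
  have h12 : 0 < 1 / 2 - H := by linarith
  refine ⟨cH H / (1 / 2 - H) * B ^ (1 / 2 - H) * T ^ (1 / 2 - H) +
    (1 / r) ^ (H - 1 / 2) / Real.Gamma (H + 1 / 2), by positivity,
    fun N m n x v hN hLR hmn hG t ht => ?_⟩
  have hL := xiLeft_pos hH hH' hT hN
  refine (approxKernel_le hH hH' hL hLR hmn.1 hG hr (hgrid N m n hN hLR hmn) ht.1).trans ?_
  rw [fracKernel_mul (by positivity) ht.1.le, add_mul]
  have htp : 0 < t ^ (H - 1 / 2) := Real.rpow_pos_of_pos ht.1 _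
  -- On `(0, T]` the constant term `weightZero` is itself dominated by a multiple of `t^(H-1/2)`.
  have h1 : 1 ≤ T ^ (1 / 2 - H) * t ^ (H - 1 / 2) := by
    rw [show H - 1 / 2 = -(1 / 2 - H) by ring, Real.rpow_neg ht.1.le, ← div_eq_mul_inv,
      one_le_div (Real.rpow_pos_of_pos ht.1 _)]
    exact Real.rpow_le_rpow ht.1.le ht.2 h12.le
  have h2 : weightZero H T N ≤ cH H / (1 / 2 - H) * B ^ (1 / 2 - H) := by
    unfold weightZero
    gcongr
    exact hleft N hN
  have h3 : weightZero H T N * 1 ≤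
      cH H / (1 / 2 - H) * B ^ (1 / 2 - H) * (T ^ (1 / 2 - H) * t ^ (H - 1 / 2)) :=
    mul_le_mul h2 h1 zero_le_one (by positivity)
  unfold fracKernel
  have e : (1 / r) ^ (H - 1 / 2) * (t ^ (H - 1 / 2) / Real.Gamma (H + 1 / 2)) =
    (1 / r) ^ (H - 1 / 2) / Real.Gamma (H + 1 / 2) * t ^ (H - 1 / 2) := by ring
  rw [e]
  linarith

/-- `L¹` convergence rate of the approximating kernels. -/
lemma exists_L1_rate (hH : 0 < H) (hH' : H < 1 / 2) (hT : 0 < T) :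
    ∃ C, 0 < C ∧ ∀ (N m n : ℕ) (x v : Fin n → Fin m → ℝ), 1 ≤ N →
      xiLeft H T N < xiRight H T N → IsLevelAndCount H N m n → IsGaussianRule H T N m n x v →
      ∀ t ∈ Icc 0 T, ∫ u in (0 : ℝ)..t, |approxKernel H T N x v u - fracKernel H u| ≤
        C * ((N : ℝ) ^ (0.21 : ℝ) * Real.exp (-(alpha / bigA H * Real.sqrt N))) := by
  obtain ⟨N0, hN0⟩ := exists_gridRatio_le hH hH' hT
  obtain ⟨C1, hC1, h1⟩ := exists_L1_error_le (T := T) hH hH' (Real.exp_pos (-1.245))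
    (Real.exp_le_one_iff.2 (by norm_num)) lt_exp_rate
  obtain ⟨Ca, hCa, ha⟩ := exists_xiLeft_rpow_le hH hH' hT
  obtain ⟨Cb, hCb, hb⟩ := exists_xiRight_rpow_le hH hH' hT
  obtain ⟨C0, hC0, h0⟩ := exists_approxKernel_le hH hH' hT
  have hA := bigA_pos hH hH'
  have hα : 0 < alpha := by norm_num [alpha]
  have hΓ : 0 < Real.Gamma (H + 1 / 2) := Real.Gamma_pos_of_pos (by linarith)
  have hKG := logConvexKernel_fracKernel hH hH'
  set J := ∫ u in (0 : ℝ)..T, u ^ (H - 1 / 2) with hJ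
  have hJint : ∀ t : ℝ, IntervalIntegrable (fun u : ℝ => u ^ (H - 1 / 2)) volume 0 t := fun t =>
    intervalIntegral.intervalIntegrable_rpow' (by linarith)
  have hJ0 : 0 ≤ J := intervalIntegral.integral_nonneg hT.le fun u hu =>
    Real.rpow_nonneg hu.1 _
  -- For `N ≤ N0` the error is merely bounded by `D`; there `S q ≥ 1`, so the factor `S` lets the
  -- claimed rate cover this range.
  set S := Real.exp (alpha / bigA H * Real.sqrt N0) with hS
  have hS0 : 0 < S := Real.exp_pos _
  set D := (C0 + (Real.Gamma (H + 1 / 2))⁻¹) * J with hD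
  have hD0 : 0 ≤ D := by positivity
  refine ⟨C1 * (Ca + Real.exp 2.49 + Cb) + D * S, by positivity,
    fun N m n x v hN hLR hmn hG t ht => ?_⟩
  have hN1 : (1 : ℝ) ≤ N := by exact_mod_cast hN
  have hL := xiLeft_pos hH hH' hT hN
  set q := (N : ℝ) ^ (0.21 : ℝ) * Real.exp (-(alpha / bigA H * Real.sqrt N)) with hq
  have hq0 : 0 < q := by positivity
  rcases le_total N0 N with h | h
  · obtain ⟨hn, hgr⟩ := hN0 N m n hN h hLR hmn
    have h2 := h1 N m n x v hL hLR hn hmn.1 hG (by linarith [exp_ratio_le]) t ht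
    refine h2.trans ?_
    have h3 : xiLeft H T N ^ (3 / 2 - H) + Real.exp (-1.245) ^ (2 * m) +
        xiRight H T N ^ (-(H + 1 / 2)) ≤ (Ca + Real.exp 2.49 + Cb) * q := by
      rw [add_mul, add_mul]
      exact add_le_add (add_le_add (ha N hN) (level_rate hH hH' hN hmn)) (hb N hN)
    have h4 := mul_le_mul_of_nonneg_left h3 hC1.le
    have h5 : 0 ≤ D * S * q := by positivity
    linarith
  · have hKh := logConvexKernel_approxKernel hH hH' hL hLR hG
    have h2 : ∫ u in (0 : ℝ)..t, |approxKernel H T N x v u - fracKernel H u| ≤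
        ∫ u in (0 : ℝ)..t, (C0 + (Real.Gamma (H + 1 / 2))⁻¹) * u ^ (H - 1 / 2) := by
      rw [intervalIntegral.integral_of_le ht.1, intervalIntegral.integral_of_le ht.1]
      apply setIntegral_mono_on _ _ measurableSet_Ioc
      · intro u hu
        have p1 := hKh.pos u hu.1
        have p2 := hKG.pos u hu.1
        have p3 := h0 N m n x v hN hLR hmn hG u ⟨hu.1, hu.2.trans ht.2⟩
        have p4 : fracKernel H u = (Real.Gamma (H + 1 / 2))⁻¹ * u ^ (H - 1 / 2) := by
          unfold fracKernel; ring
        rw [abs_le]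
        constructor <;> linarith
      · exact (intervalIntegrable_iff_integrableOn_Ioc_of_le ht.1).1
          ((hKh.integrable t).sub (hKG.integrable t)).abs
      · exact (intervalIntegrable_iff_integrableOn_Ioc_of_le ht.1).1 ((hJint t).const_mul _)
    have h3 : ∫ u in (0 : ℝ)..t, u ^ (H - 1 / 2) ≤ J := by
      apply intervalIntegral.integral_mono_interval le_rfl ht.1 ht.2 _ (hJint T)
      filter_upwards [ae_restrict_mem measurableSet_Ioc] with u hu
      exact Real.rpow_nonneg hu.1.le _
    rw [intervalIntegral.integral_const_mul] at h2
    have h4 : ∫ u in (0 : ℝ)..t, |approxKernel H T N x v u - fracKernel H u| ≤ D :=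
      h2.trans (by rw [hD]; gcongr)
    have h5 : 1 ≤ S * q := by
      have e1 : 1 ≤ S * Real.exp (-(alpha / bigA H * Real.sqrt N)) := by
        rw [hS, ← Real.exp_add, Real.one_le_exp_iff]
        have : alpha / bigA H * Real.sqrt N ≤ alpha / bigA H * Real.sqrt N0 := by gcongr
        linarith
      have e2 : (1 : ℝ) ≤ (N : ℝ) ^ (0.21 : ℝ) := Real.one_le_rpow hN1 (by norm_num)
      calc (1 : ℝ) ≤ S * Real.exp (-(alpha / bigA H * Real.sqrt N)) := e1
        _ ≤ (N : ℝ) ^ (0.21 : ℝ) * (S * Real.exp (-(alpha / bigA H * Real.sqrt N))) :=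
          le_mul_of_one_le_left (by positivity) e2
        _ = S * q := by rw [hq]; ring
    have h6 := mul_le_mul_of_nonneg_left h5 hD0
    have h7 : 0 ≤ C1 * (Ca + Real.exp 2.49 + Cb) * q := by positivity
    linarith

end RoughHeston

theorem corollary3p5 (H T lam nu rho : ℝ) (hH : 0 < H) (hH' : H < 1 / 2) (hT : 0 < T)
    (hrho : rho ∈ Set.Icc (-1 : ℝ) 1) :
    ∃ C : ℝ, 0 < C ∧
      ∀ N m n : ℕ, 1 ≤ N → RoughHeston.xiLeft H T N < RoughHeston.xiRight H T N →
      RoughHeston.IsLevelAndCount H N m n →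
      ∀ x v : Fin n → Fin m → ℝ, RoughHeston.IsGaussianRule H T N m n x v →
      ∀ a ∈ Set.Icc (0 : ℝ) 1, ∀ b : ℝ, ∀ psi psiHat : ℝ → ℂ,
      RoughHeston.IsRiccatiSolution (RoughHeston.fracKernel H) lam nu rho T
        ((a : ℂ) + Complex.I * b) psi →
      RoughHeston.IsRiccatiSolution (RoughHeston.approxKernel H T N x v) lam nu rho T
        ((a : ℂ) + Complex.I * b) psiHat →
      ∀ t ∈ Set.Icc (0 : ℝ) T,
        ‖psiHat t - psi t‖ ≤ C * (1 + b ^ 4) * (N : ℝ) ^ (0.21 : ℝ) *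
          Real.exp (-(RoughHeston.alpha / RoughHeston.bigA H * Real.sqrt N)) := by
  open RoughHeston in
  obtain ⟨C0, hC0, h0⟩ := exists_approxKernel_le hH hH' hT
  obtain ⟨C1, hC1, h1⟩ := exists_L1_rate hH hH' hT
  have hΓ : 0 < Real.Gamma (H + 1 / 2) := Real.Gamma_pos_of_pos (by linarith)
  -- Stability needs one domination constant for both kernels, hence the sum of the two.
  obtain ⟨B, hB, hstab⟩ := riccati_stability (T := T) (C0 := C0 + (Real.Gamma (H + 1 / 2))⁻¹)
    (lam := lam) (nu := nu) hH hT.le (by positivity) hrho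
  refine ⟨B * C1, by positivity, fun N m n hN hLR hmn x v hG a ha b psi psiHat hpsi hpsiHat t ht =>
    ?_⟩
  have hL := xiLeft_pos hH hH' hT hN
  have hN0 : (0 : ℝ) < N := by exact_mod_cast hN
  have h := hstab (fracKernel H) (approxKernel H T N x v) (logConvexKernel_fracKernel hH hH')
    (fun t ht => by
      have h1 : 0 < t ^ (H - 1 / 2) := Real.rpow_pos_of_pos ht.1 _
      have h2 : fracKernel H t = (Real.Gamma (H + 1 / 2))⁻¹ * t ^ (H - 1 / 2) := by
        unfold fracKernel; ring
      rw [h2]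
      gcongr
      linarith)
    (logConvexKernel_approxKernel hH hH' hL hLR hG) continuous_approxKernel
    (fun t ht => (h0 N m n x v hN hLR hmn hG t ht).trans (by
      have h1 : 0 < t ^ (H - 1 / 2) := Real.rpow_pos_of_pos ht.1 _
      gcongr
      have : 0 < (Real.Gamma (H + 1 / 2))⁻¹ := by positivity
      linarith))
    _ (by positivity) (h1 N m n x v hN hLR hmn hG) a ha b psi psiHat hpsi hpsiHat t ht
  refine h.trans (le_of_eq ?_)
  ring
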